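/- **Definitions.** An *$H^*$-category* is a category enriched in finite-dimensional complex Hilbert spaces (inner products are antilinear in the first variable), with antilinear maps $*\colon \mathrm{Hom}(x,y)\to\mathrm{Hom}(y,x)$ such that $f^{**}=f$, $(fg)^*=g^*f^*$, $(fg,h)=(g,f^*h)$ and $(fg,h)=(f,hg^*)$ whenever these make sense. A (finite-dimensional) *2-Hilbert space* is an $H^*$-category which is Cauchy complete (it has all finite direct sums, including a zero object, and all idempotents split) and has finitely many isomorphism classes of simple objects, an object $x$ being simple if $\dim\mathrm{End}(x)=1$. The 2-category $2\mathcal{H}\mathrm{ilb}$ has 2-Hilbert spaces as objects, linear $*$-functors ($F(f^*)=F(f)^*$) as morphisms, and natural transformations as 2-morphisms. A morphism $f$ in a 2-Hilbert space is unitary if $f^*f=\mathrm{id}$ and $ff^*=\mathrm{id}$; a natural transformation is unitary if its components are; a linear $*$-functor is unitary if it is a unitary map on each hom-space. For linear $*$-functors $F,F'$ on a 2-Hilbert space, $\mathrm{Nat}(F,F')$ is a Hilbert space with $\langle\theta,\theta'\rangle=\sum_i k_i\,(\theta_{e_i},\theta'_{e_i})$, where $e_i$ runs over representatives of the isomorphism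 classes of simple objects and $k_i=(\mathrm{id}_{e_i},\mathrm{id}_{e_i})$. Let $G$ be a finite group. A *unitary 2-representation* $\alpha$ of $G$ consists of a 2-Hilbert space $H_\alpha$, unitary linear $*$-functors $\alpha_g\colon H_\alpha\to H_\alpha$ ($g\in G$), and unitary natural isomorphisms $a(e)\colon\mathrm{id}\Rightarrow\alpha_e$ and $a(g_2,g_1)\colon\alpha_{g_2}\alpha_{g_1}\Rightarrow\alpha_{g_2g_1}$ satisfying the usual unit and associativity equations. A *morphism* $\sigma\colon\alpha\to\beta$ consists of a linear $*$-functor $\sigma\colon H_\alpha\to H_\beta$ and unitary natural isomorphisms $\sigma(g)\colon\beta_g\sigma\Rightarrow\sigma\alpha_g$ compatible with $a$ and $b$; a *2-morphism* $\sigma\Rightarrow\rho$ is a natural transformation $\gamma\colon\sigma\Rightarrow\rho$ which commutes with all $\sigma(g)$ and $\rho(g)$ (a modification). These form a 2-category $2\mathcal{R}\mathrm{ep}(G)$. Its Grothendieck category $[2\mathcal{R}\mathrm{ep}(G)]$ has the same objects, and isomorphism classes of 1-morphisms as morphisms. The loop groupoid of $G$ has the elements of $G$ as objects, and a morphism $g\to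 hgh^{-1}$ for each $h\in G$. The category $\mathrm{Hilb}_G(G)$ of unitary equivariant vector bundles over $G$ consists of the functors from the loop groupoid to finite-dimensional Hilbert spaces (and linear maps) which send all morphisms to unitary maps, and of natural transformations between them. The 2-character $\chi_\alpha\in\mathrm{Hilb}_G(G)$ of $\alpha$ has fibres $\chi_\alpha(g)=\mathrm{Nat}(\mathrm{id}_{H_\alpha},\alpha_g)$, and $h\colon g\to hgh^{-1}$ acts by $$(\chi_\alpha(h)\theta)_x=a(hg,h^{-1})_x\circ a(h,g)_{\alpha_{h^{-1}}x}\circ\alpha_h(\theta_{\alpha_{h^{-1}}x})\circ a(h,h^{-1})_x^{-1}\circ a(e)_x .$$ Let $F\colon H\to K$ be a morphism in $2\mathcal{H}\mathrm{ilb}$. A *right adjoint* of $F$ is a linear $*$-functor $F^*\colon K\to H$ with a unit $\eta$ and a counit $\epsilon$ satisfying the triangle equations; let $\phi\colon\mathrm{Hom}(Fx,y)\to\mathrm{Hom}(x,F^*y)$ be the corresponding isomorphisms. The canonical even-handed structure $\Psi$ makes $F^*$ a left adjoint of $F$, through the natural isomorphisms $$\Psi(\phi)\colon\mathrm{Hom}(F^*y,x)\to\mathrm{Hom}(y,Fx),\qquad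 \Psi(\phi)(k)=\bigl(\phi^*(k^*)\bigr)^*,$$ where $\phi^*$ is the Hilbert space adjoint of $\phi$. Write $\Psi(\eta)\colon\mathrm{id}_K\Rightarrow FF^*$ for its unit. For a morphism $\sigma\colon\alpha\to\beta$ in $2\mathcal{R}\mathrm{ep}(G)$, a right adjoint $(\sigma^*,\eta,\epsilon)$ of the functor $\sigma$ in $2\mathcal{H}\mathrm{ilb}$, and $g\in G$, define the linear map $\chi(\sigma)_g\colon\chi_\alpha(g)\to\chi_\beta(g)$ by $$(\chi(\sigma)_g\theta)_y=\beta_g(\epsilon_y)\circ\sigma(g)^{-1}_{\sigma^*y}\circ\sigma(\theta_{\sigma^*y})\circ\Psi(\eta)_y .$$ **Theorem.** Let $G$ be a finite group. Every morphism $\sigma\colon\alpha\to\beta$ of unitary 2-representations of $G$ has a right adjoint in $2\mathcal{H}\mathrm{ilb}$, and the maps $\chi(\sigma)_g$ 1. do not depend on the choice of the right adjoint $(\sigma^*,\eta,\epsilon)$; 2. form a morphism $\chi(\sigma)\colon\chi_\alpha\to\chi_\beta$ of equivariant vector bundles over $G$, that is, $\chi_\beta(h)\,\chi(\sigma)_g=\chi(\sigma)_{hgh^{-1}}\,\chi_\alpha(h)$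 for all $g,h\in G$; 3. depend only on the isomorphism class of $\sigma$: if $\sigma\cong\rho$ in $2\mathcal{R}\mathrm{ep}(G)$, then $\chi(\sigma)=\chi(\rho)$; 4. are functorial: $\chi(\mathrm{id}_\alpha)=\mathrm{id}$ and $\chi(\tau\sigma)=\chi(\tau)\chi(\sigma)$ for morphisms $\sigma\colon\alpha\to\beta$ and $\tau\colon\beta\to\gamma$. Hence $\alpha\mapsto\chi_\alpha$, $[\sigma]\mapsto\chi(\sigma)$ is a functor $\chi\colon[2\mathcal{R}\mathrm{ep}(G)]\to\mathrm{Hilb}_G(G)$. -/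

import Mathlib

open CategoryTheory CategoryTheory.Limits

universe v u w

namespace TwoHilbert

/-- An `H*`-category: a category enriched in finite-dimensional Hilbert spaces, with antilinear
involutions `f ↦ f*` on morphisms satisfying `(g ∘ f)* = f* ∘ g*`, `(g ∘ f, h) = (f, g* ∘ h)` and
`(g ∘ f, h) = (g, h ∘ f*)`. Inner products are antilinear in the first variable. -/
class HStarCategory (H : Type u) [Category.{v} H] [Preadditive H] [Linear ℂ H] where
  innerCore (x y : H) : InnerProductSpace.Core ℂ (x ⟶ y)
  finite_hom (x y : H) : Module.Finite ℂ (x ⟶ y)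
  dag {x y : H} (f : x ⟶ y) : y ⟶ x
  dag_add {x y : H} (f g : x ⟶ y) : dag (f + g) = dag f + dag g
  dag_smul {x y : H} (c : ℂ) (f : x ⟶ y) : dag (c • f) = (starRingEnd ℂ c) • dag f
  dag_dag {x y : H} (f : x ⟶ y) : dag (dag f) = f
  dag_comp {x y z : H} (f : x ⟶ y) (g : y ⟶ z) : dag (f ≫ g) = dag g ≫ dag f
  inner_comp_left {x y z : H} (f : x ⟶ y) (g : y ⟶ z) (h : x ⟶ z) :
    (innerCore x z).inner (f ≫ g) h = (innerCore x y).inner f (h ≫ dag g)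
  inner_comp_right {x y z : H} (f : x ⟶ y) (g : y ⟶ z) (h : x ⟶ z) :
    (innerCore x z).inner (f ≫ g) h = (innerCore y z).inner g (dag f ≫ h)

/-- An object of a `ℂ`-linear category is simple if its endomorphisms form a line. -/
def IsSimple {H : Type u} [Category.{v} H] [Preadditive H] [Linear ℂ H] (x : H) : Prop :=
  Module.finrank ℂ (x ⟶ x) = 1

/-- Isomorphism of simple objects. -/
def simpleSetoid (H : Type u) [Category.{v} H] [Preadditive H] [Linear ℂ H] :
    Setoid {x : H // IsSimple x} where
  r x y := Nonempty (x.1 ≅ y.1)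
  iseqv := ⟨fun x => ⟨Iso.refl x.1⟩, fun ⟨e⟩ => ⟨e.symm⟩, fun ⟨e⟩ ⟨e'⟩ => ⟨e ≪≫ e'⟩⟩

/-- The isomorphism classes of simple objects. -/
def SimpleClass (H : Type u) [Category.{v} H] [Preadditive H] [Linear ℂ H] : Type u :=
  Quotient (simpleSetoid H)

/-- A finite-dimensional 2-Hilbert space: a Cauchy complete `H*`-category (it has finite direct sums
and all idempotents split) with finitely many isomorphism classes of simple objects. -/
class TwoHilbertSpace (H : Type u) [Category.{v} H] [Preadditive H] [Linear ℂ H] extends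
    HStarCategory H where
  hasFiniteBiproducts : HasFiniteBiproducts H
  isIdempotentComplete : IsIdempotentComplete H
  finite_simpleClass : Finite (SimpleClass H)

section HStar

variable {H : Type u} [Category.{v} H] [Preadditive H] [Linear ℂ H]

section
variable [HStarCategory H]

/-- The adjoint `f*` of a morphism. -/
abbrev dag {x y : H} (f : x ⟶ y) : y ⟶ x := HStarCategory.dag f

/-- The inner product `(f, g)` on a hom-space. -/
def ip {x y : H} (f g : x ⟶ y) : ℂ := (HStarCategory.innerCore x y).inner f g

/-- A morphism `f` is unitary if `f* f = 1` and `f f* = 1`. -/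
def IsUnitaryHom {x y : H} (f : x ⟶ y) : Prop := f ≫ dag f = 𝟙 x ∧ dag f ≫ f = 𝟙 y

lemma ip_comp_left {x y z : H} (f : x ⟶ y) (g : y ⟶ z) (h : x ⟶ z) :
    ip (f ≫ g) h = ip f (h ≫ dag g) := HStarCategory.inner_comp_left f g h

lemma ip_comp_right {x y z : H} (f : x ⟶ y) (g : y ⟶ z) (h : x ⟶ z) :
    ip (f ≫ g) h = ip g (dag f ≫ h) := HStarCategory.inner_comp_right f g h

lemma ip_conj {x y : H} (f g : x ⟶ y) : (starRingEnd ℂ) (ip g f) = ip f g :=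
  (HStarCategory.innerCore x y).conj_inner_symm f g

lemma ip_self_nonneg {x y : H} (f : x ⟶ y) : 0 ≤ (ip f f).re :=
  (HStarCategory.innerCore x y).re_inner_nonneg f

lemma ip_add_left {x y : H} (f f' g : x ⟶ y) : ip (f + f') g = ip f g + ip f' g :=
  (HStarCategory.innerCore x y).add_left f f' g

lemma ip_smul_left {x y : H} (c : ℂ) (f g : x ⟶ y) :
    ip (c • f) g = (starRingEnd ℂ) c * ip f g :=
  (HStarCategory.innerCore x y).smul_left f g c

lemma ip_smul_right {x y : H} (c : ℂ) (f g : x ⟶ y) : ip f (c • g) = c * ip f g := by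
  rw [← ip_conj, ip_smul_left, map_mul, ip_conj]; simp

lemma ip_definite {x y : H} (f : x ⟶ y) (h : ip f f = 0) : f = 0 :=
  (HStarCategory.innerCore x y).definite f h

lemma ip_zero_left {x y : H} (g : x ⟶ y) : ip (0 : x ⟶ y) g = 0 := by
  have := ip_smul_left (0 : ℂ) (0 : x ⟶ y) g
  simpa using this

lemma ip_self_im {x y : H} (f : x ⟶ y) : (ip f f).im = 0 :=
  Complex.conj_eq_iff_im.mp (ip_conj f f)

lemma dag_id (x : H) : dag (𝟙 x) = 𝟙 x := by
  have h := HStarCategory.dag_comp (dag (𝟙 x)) (𝟙 x)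
  rw [Category.comp_id, HStarCategory.dag_dag, Category.comp_id] at h
  exact h.symm

lemma dag_zero (x y : H) : dag (0 : x ⟶ y) = 0 := by
  have := HStarCategory.dag_smul (0 : ℂ) (0 : x ⟶ y)
  simpa using this

lemma IsUnitaryHom.dag_isoHom {x y : H} (e : x ≅ y) (h : IsUnitaryHom e.hom) :
    dag e.hom = e.inv := by
  rw [← Category.id_comp (dag e.hom), ← e.inv_hom_id, Category.assoc, h.1, Category.comp_id]

lemma ip_comp_unitary_right {x y z : H} (f f' : x ⟶ y) (u : y ⟶ z) (hu : IsUnitaryHom u) :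
    ip (f ≫ u) (f' ≫ u) = ip f f' := by
  rw [ip_comp_left, Category.assoc, hu.1, Category.comp_id]

lemma ip_comp_unitary_left {x y z : H} (u : x ⟶ y) (hu : IsUnitaryHom u) (f f' : y ⟶ z) :
    ip (u ≫ f) (u ≫ f') = ip f f' := by
  rw [ip_comp_right, ← Category.assoc, hu.2, Category.id_comp]

lemma IsUnitaryHom.id (x : H) : IsUnitaryHom (𝟙 x) := by
  simp [IsUnitaryHom, dag_id]

lemma IsUnitaryHom.comp {x y z : H} {f : x ⟶ y} {g : y ⟶ z} (hf : IsUnitaryHom f)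
    (hg : IsUnitaryHom g) : IsUnitaryHom (f ≫ g) := by
  constructor
  · rw [dag, HStarCategory.dag_comp, Category.assoc, ← Category.assoc g, hg.1, Category.id_comp,
      hf.1]
  · rw [dag, HStarCategory.dag_comp, Category.assoc, ← Category.assoc _ f, hf.2, Category.id_comp,
      hg.2]

/-- The Hilbert space structure on the hom-spaces. -/
@[reducible] noncomputable def homNormed (x y : H) : NormedAddCommGroup (x ⟶ y) :=
  (HStarCategory.innerCore x y).toNormedAddCommGroup

/-- The Hilbert space structure on the hom-spaces. -/
@[reducible] noncomputable def homInner (x y : H) :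
    letI := homNormed x y
    InnerProductSpace ℂ (x ⟶ y) :=
  InnerProductSpace.ofCore (HStarCategory.innerCore x y).toCore

/-- A non-simple, non-zero object has a non-trivial idempotent. -/
lemma exists_idempotent (x : H) (hx : 2 ≤ Module.finrank ℂ (x ⟶ x)) :
    ∃ p : x ⟶ x, p ≫ p = p ∧ p ≠ 0 ∧ p ≠ 𝟙 x := by
  classical
  have : Module.Finite ℂ (x ⟶ x) := HStarCategory.finite_hom x x
  have : Nontrivial (x ⟶ x) := Module.nontrivial_of_finrank_pos (R := ℂ) (by omega)
  -- a self-adjoint endomorphism which is not a scalar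
  obtain ⟨a, ha, hns⟩ : ∃ a : x ⟶ x, dag a = a ∧ ∀ c : ℂ, a ≠ c • 𝟙 x := by
    by_contra! hcon
    have hall : ∀ f : x ⟶ x, ∃ c : ℂ, c • 𝟙 x = f := by
      intro f
      obtain ⟨c, hc⟩ := hcon (f + dag f) (by
        rw [dag, HStarCategory.dag_add, HStarCategory.dag_dag, add_comm])
      obtain ⟨d, hd⟩ := hcon (Complex.I • f + dag (Complex.I • f)) (by
        rw [dag, HStarCategory.dag_add, HStarCategory.dag_dag, add_comm])
      rw [dag, HStarCategory.dag_smul, Complex.conj_I] at hd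
      refine ⟨(1/2) * c - (Complex.I / 2) * d, ?_⟩
      rw [sub_smul, mul_smul, mul_smul, ← hc, ← hd]
      simp only [smul_add, smul_smul, neg_smul, smul_neg]
      rw [show Complex.I / 2 * Complex.I = -(1/2) by
        rw [div_mul_eq_mul_div, Complex.I_mul_I]; norm_num]
      module
    have := finrank_le_one (R := ℂ) (𝟙 x) hall
    omega
  let L : (x ⟶ x) →ₗ[ℂ] (x ⟶ x) := Linear.rightComp ℂ x a
  obtain ⟨c, hc⟩ := Module.End.exists_eigenvalue (K := ℂ) L
  obtain ⟨f, hf⟩ := hc.exists_hasEigenvector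
  have hfe : f ≫ a = c • f := hf.apply_eq_smul
  have hf0 : f ≠ 0 := hf.2
  have hff : ip f f ≠ 0 := fun h => hf0 (ip_definite f h)
  have hcr : (starRingEnd ℂ) c = c := by
    have h1 := ip_comp_left f a f
    rw [ha, hfe, ip_smul_left, ip_smul_right] at h1
    exact mul_right_cancel₀ hff h1
  let b : x ⟶ x := a - c • 𝟙 x
  have hb : dag b = b := by
    have : b = a + (-c) • 𝟙 x := by simp [b, sub_eq_add_neg]
    rw [this, dag, HStarCategory.dag_add, HStarCategory.dag_smul]
    change dag a + _ • dag (𝟙 x) = _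
    rw [ha, dag_id, map_neg, hcr]
  have hb0 : b ≠ 0 := fun h => hns c (sub_eq_zero.mp h)
  have hfb : f ≫ b = 0 := by simp [b, hfe]
  clear_value b
  let M : (x ⟶ x) →ₗ[ℂ] (x ⟶ x) := Linear.rightComp ℂ x b
  have hM : ∀ g, M g = g ≫ b := fun g => rfl
  have hdisj : ∀ g : x ⟶ x, g ≫ b = 0 → (∃ k : x ⟶ x, k ≫ b = g) → g = 0 := by
    rintro g hg ⟨k, rfl⟩
    apply ip_definite
    rw [ip_comp_left, hb, hg, ← ip_conj, ip_zero_left, map_zero]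
  have hdis : Disjoint (LinearMap.range M) (LinearMap.ker M) := by
    rw [Submodule.disjoint_def]
    intro g hg hg'
    exact hdisj g hg' hg
  have htop : LinearMap.range M ⊔ LinearMap.ker M = ⊤ :=
    Submodule.eq_top_of_disjoint _ _ (LinearMap.finrank_range_add_finrank_ker M).ge hdis
  obtain ⟨q, ⟨k, hk⟩, p, hp, hqp⟩ := Submodule.mem_sup.mp (htop ▸ Submodule.mem_top :
    𝟙 x ∈ LinearMap.range M ⊔ LinearMap.ker M)
  replace hp : p ≫ b = 0 := hp
  replace hk : k ≫ b = q := hk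
  have hq : q = 𝟙 x - p := by rw [← hqp]; abel
  have hpp : p ≫ p = p := by
    have h1 : p ≫ q = 0 := by
      refine hdisj _ ?_ ⟨p ≫ k, by rw [Category.assoc, hk]⟩
      rw [hq, Preadditive.comp_sub, Category.comp_id, Preadditive.sub_comp, Category.assoc, hp,
        Limits.comp_zero, sub_zero]
    rw [hq, Preadditive.comp_sub, Category.comp_id, sub_eq_zero] at h1
    exact h1.symm
  refine ⟨p, hpp, ?_, ?_⟩
  · rintro rfl
    rw [sub_zero] at hq
    exact hf0 (hdisj f hfb ⟨f ≫ k, by rw [Category.assoc, hk, hq, Category.comp_id]⟩)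
  · rintro rfl
    rw [Category.id_comp] at hp
    exact hb0 hp

/-- A retract which is cut out by a proper idempotent has fewer endomorphisms. -/
lemma finrank_lt_of_retract {x y : H} (i : y ⟶ x) (r : x ⟶ y) (hir : i ≫ r = 𝟙 y)
    (h : r ≫ i ≠ 𝟙 x) : Module.finrank ℂ (y ⟶ y) < Module.finrank ℂ (x ⟶ x) := by
  have : Module.Finite ℂ (x ⟶ x) := HStarCategory.finite_hom x x
  let T : (y ⟶ y) →ₗ[ℂ] (x ⟶ x) := Linear.leftComp ℂ x r ∘ₗ Linear.rightComp ℂ y i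
  have hT : ∀ f, T f = r ≫ f ≫ i := fun f => rfl
  have hinj : Function.Injective T := by
    intro f g hfg
    rw [hT, hT] at hfg
    have := congrArg (fun k => i ≫ k ≫ r) hfg
    simpa [hir, reassoc_of% hir] using this
  rw [← LinearMap.finrank_range_of_inj hinj]
  apply Submodule.finrank_lt
  intro htop
  obtain ⟨f, hf⟩ : 𝟙 x ∈ LinearMap.range T := htop ▸ Submodule.mem_top
  rw [hT] at hf
  apply h
  have h2 : (r ≫ i) ≫ (r ≫ f ≫ i) = r ≫ f ≫ i := by
    simp [reassoc_of% hir]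
  rwa [hf, Category.comp_id] at h2

end

variable [TwoHilbertSpace H]

/-- Every object is, in finitely many steps, a sum of simple ones; this is the corresponding
induction principle. -/
theorem simple_induction (P : H → Prop) (hsimple : ∀ x, IsSimple x → P x)
    (hzero : ∀ x : H, 𝟙 x = 0 → P x)
    (hsum : ∀ (x y z : H) (i : y ⟶ x) (r : x ⟶ y) (j : z ⟶ x) (s : x ⟶ z),
      r ≫ i + s ≫ j = 𝟙 x → P y → P z → P x) (x : H) : P x := by
  have : IsIdempotentComplete H := TwoHilbertSpace.isIdempotentComplete
  generalize hn : Module.finrank ℂ (x ⟶ x) = n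
  induction n using Nat.strong_induction_on generalizing x with
  | _ n ih =>
    have : Module.Finite ℂ (x ⟶ x) := HStarCategory.finite_hom x x
    rcases Nat.lt_or_ge n 2 with h | h
    · rcases Nat.lt_or_ge n 1 with h0 | h1
      · apply hzero
        have := Module.finrank_zero_iff.mp (show Module.finrank ℂ (x ⟶ x) = 0 by omega)
        exact Subsingleton.elim _ _
      · exact hsimple x (show Module.finrank ℂ (x ⟶ x) = 1 by omega)
    · obtain ⟨p, hp, hp0, hp1⟩ := exists_idempotent x (hn ▸ h)
      obtain ⟨y, i, r, hir, hri⟩ := IsIdempotentComplete.idempotents_split x p hp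
      obtain ⟨z, j, s, hjs, hsj⟩ := IsIdempotentComplete.idempotents_split x (𝟙 x - p)
        (by simp [Preadditive.sub_comp, Preadditive.comp_sub, hp])
      refine hsum x y z i r j s (by rw [hri, hsj]; abel) ?_ ?_
      · refine ih _ ?_ y rfl
        rw [← hn]
        exact finrank_lt_of_retract i r hir (hri ▸ hp1)
      · refine ih _ ?_ z rfl
        rw [← hn]
        refine finrank_lt_of_retract j s hjs ?_
        rw [hsj]
        intro h
        exact hp0 (by simpa using h)

noncomputable instance : Fintype (SimpleClass H) :=
  @Fintype.ofFinite _ TwoHilbertSpace.finite_simpleClass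

/-- A chosen representative of an isomorphism class of simple objects. -/
noncomputable def SimpleClass.rep (c : SimpleClass H) : H := (Quotient.out c).1

lemma SimpleClass.isSimple_rep (c : SimpleClass H) : IsSimple c.rep := (Quotient.out c).2

/-- The class of a simple object. -/
def SimpleClass.mk (x : H) (hx : IsSimple x) : SimpleClass H :=
  Quotient.mk (simpleSetoid H) ⟨x, hx⟩

lemma SimpleClass.mk_rep (c : SimpleClass H) : SimpleClass.mk c.rep c.isSimple_rep = c :=
  Quotient.out_eq c

lemma SimpleClass.mk_eq_iff {x y : H} (hx : IsSimple x) (hy : IsSimple y) :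
    SimpleClass.mk x hx = SimpleClass.mk y hy ↔ Nonempty (x ≅ y) :=
  Quotient.eq (r := simpleSetoid H)

lemma SimpleClass.rep_iso (x : H) (hx : IsSimple x) :
    Nonempty ((SimpleClass.mk x hx).rep ≅ x) :=
  (SimpleClass.mk_eq_iff (SimpleClass.isSimple_rep _) hx).mp (SimpleClass.mk_rep _)

lemma IsSimple.id_ne_zero {x : H} (hx : IsSimple x) : 𝟙 x ≠ 0 := by
  intro h
  have : Subsingleton (x ⟶ x) := ⟨fun f g => by
    rw [← Category.comp_id f, ← Category.comp_id g, h, Limits.comp_zero, Limits.comp_zero]⟩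
  have h1 : Module.finrank ℂ (x ⟶ x) = 0 := Module.finrank_zero_of_subsingleton
  rw [IsSimple] at hx
  omega

lemma IsSimple.exists_smul {x : H} (hx : IsSimple x) (f : x ⟶ x) : ∃ c : ℂ, c • 𝟙 x = f :=
  (finrank_eq_one_iff_of_nonzero' (𝟙 x) hx.id_ne_zero).mp hx f

lemma IsSimple.of_iso {x y : H} (hx : IsSimple x) (e : x ≅ y) : IsSimple y := by
  have : (x ⟶ x) ≃ₗ[ℂ] (y ⟶ y) := Linear.homCongr ℂ e e
  rw [IsSimple, ← this.finrank_eq]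
  exact hx

end HStar

/-- The type of finite-dimensional 2-Hilbert spaces. -/
structure TwoHilb : Type (max (u + 1) (v + 1)) where
  carrier : Type u
  [category : Category.{v} carrier]
  [preadditive : Preadditive carrier]
  [linear : Linear ℂ carrier]
  [twoHilbertSpace : TwoHilbertSpace carrier]

attribute [instance] TwoHilb.category TwoHilb.preadditive TwoHilb.linear TwoHilb.twoHilbertSpace

instance : CoeSort TwoHilb.{v, u} (Type u) := ⟨TwoHilb.carrier⟩

/-- Linear `*`-functors between 2-Hilbert spaces. -/
structure StarFunctor (H K : TwoHilb.{v, u}) where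
  functor : H ⥤ K
  [additive : functor.Additive]
  [linear : functor.Linear ℂ]
  map_dag {x y : H} (f : x ⟶ y) : functor.map (dag f) = dag (functor.map f)

namespace StarFunctor

attribute [instance] StarFunctor.additive StarFunctor.linear

variable {H K L : TwoHilb.{v, u}}

/-- The identity linear `*`-functor. -/
abbrev id (H : TwoHilb.{v, u}) : StarFunctor H H where
  functor := 𝟭 H
  map_dag _ := rfl

/-- Composition of linear `*`-functors (`F` first, then `F'`). -/
abbrev comp (F : StarFunctor H K) (F' : StarFunctor K L) : StarFunctor H L where
  functor := F.functor ⋙ F'.functor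
  map_dag f := by simp [F.map_dag, F'.map_dag]

/-- A linear `*`-functor is unitary if it is unitary on hom-spaces. -/
def IsUnitary (F : StarFunctor H K) : Prop :=
  ∀ x y : H, (∀ f g : x ⟶ y, ip (F.functor.map f) (F.functor.map g) = ip f g) ∧
    Function.Surjective (fun f : x ⟶ y => F.functor.map f)

lemma map_unitary (F : StarFunctor H K) {x y : H} {f : x ⟶ y} (hf : IsUnitaryHom f) :
    IsUnitaryHom (F.functor.map f) := by
  constructor
  · rw [← F.map_dag, ← Functor.map_comp, hf.1, CategoryTheory.Functor.map_id]
  · rw [← F.map_dag, ← Functor.map_comp, hf.2, CategoryTheory.Functor.map_id]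

end StarFunctor

section NatInner

variable {H K : TwoHilb.{v, u}}

/-- The scale factor `(1, 1)` of an object. -/
noncomputable def scale (x : H) : ℂ := ip (𝟙 x) (𝟙 x)

lemma scale_im (x : H) : (scale x).im = 0 := ip_self_im _

lemma scale_re_nonneg (x : H) : 0 ≤ (scale x).re := ip_self_nonneg _

lemma scale_ne_zero {x : H} (hx : IsSimple x) : scale x ≠ 0 :=
  fun h => hx.id_ne_zero (ip_definite _ h)

/-- The inner product `∑ᵢ kᵢ (θ_{eᵢ}, θ'_{eᵢ})` of natural transformations, where `eᵢ` runs over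
representatives of the isomorphism classes of simple objects, with scale factors `kᵢ`. -/
noncomputable def natInner {F F' : StarFunctor H K} (θ θ' : F.functor ⟶ F'.functor) : ℂ :=
  ∑ c : SimpleClass H, scale c.rep * ip (θ.app c.rep) (θ'.app c.rep)

lemma natTrans_eq_zero {F F' : StarFunctor H K} (θ : F.functor ⟶ F'.functor)
    (h : ∀ c : SimpleClass H, θ.app c.rep = 0) : θ = 0 := by
  ext x
  change θ.app x = 0
  induction x using simple_induction with
  | hsimple x hx =>
    obtain ⟨e⟩ := SimpleClass.rep_iso x hx
    have := θ.naturality e.inv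
    rw [h, Limits.comp_zero] at this
    have h2 := congrArg (fun k => k ≫ F'.functor.map e.hom) this
    simpa [← Functor.map_comp] using h2.symm
  | hzero x hx =>
    rw [← Category.id_comp (θ.app x), ← F.functor.map_id, hx, Functor.map_zero, Limits.zero_comp]
  | hsum x y z i r j s hrs hy hz =>
    rw [← Category.id_comp (θ.app x), ← F.functor.map_id, ← hrs, Functor.map_add,
      Preadditive.add_comp, Functor.map_comp, Functor.map_comp, Category.assoc, Category.assoc,
      θ.naturality i, θ.naturality j, hy, hz]
    simp

/-- The Hilbert space structure on natural transformations. -/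
@[reducible] noncomputable def natCore (F F' : StarFunctor H K) :
    InnerProductSpace.Core ℂ (F.functor ⟶ F'.functor) where
  inner := natInner
  conj_inner_symm θ θ' := by
    simp only [natInner, map_sum, map_mul, ip_conj, scale]
  re_inner_nonneg θ := by
    simp only [natInner, map_sum]
    refine Finset.sum_nonneg fun c _ => ?_
    change 0 ≤ (scale c.rep * ip (θ.app c.rep) (θ.app c.rep)).re
    rw [Complex.mul_re, scale_im, zero_mul, sub_zero]
    exact mul_nonneg (scale_re_nonneg _) (ip_self_nonneg _)
  add_left θ θ' θ'' := by
    simp only [natInner, NatTrans.app_add, ip_add_left, mul_add, Finset.sum_add_distrib]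
  smul_left θ θ' c := by
    simp only [natInner, NatTrans.app_smul, ip_smul_left, Finset.mul_sum]
    exact Finset.sum_congr rfl fun _ _ => by ring
  definite θ h := by
    apply natTrans_eq_zero
    intro c
    have h1 : ∑ c : SimpleClass H, (scale c.rep).re * (ip (θ.app c.rep) (θ.app c.rep)).re = 0 := by
      have := congrArg Complex.re h
      change (natInner θ θ).re = 0 at this
      rw [natInner, Complex.re_sum] at this
      rw [← this]
      refine Finset.sum_congr rfl fun c _ => ?_
      rw [Complex.mul_re, scale_im, zero_mul, sub_zero]
    have h2 := (Finset.sum_eq_zero_iff_of_nonneg fun c _ =>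
      mul_nonneg (scale_re_nonneg _) (ip_self_nonneg _)).mp h1 c (Finset.mem_univ c)
    rcases mul_eq_zero.mp h2 with h3 | h3
    · exact absurd (Complex.ext h3 (scale_im _)) (scale_ne_zero c.isSimple_rep)
    · exact ip_definite _ (Complex.ext h3 (ip_self_im _))

lemma finite_nat (F F' : StarFunctor H K) : Module.Finite ℂ (F.functor ⟶ F'.functor) := by
  have (c : SimpleClass H) :
      Module.Finite ℂ (F.functor.obj c.rep ⟶ F'.functor.obj c.rep) := HStarCategory.finite_hom _ _
  let T : (F.functor ⟶ F'.functor) →ₗ[ℂ]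
      ((c : SimpleClass H) → (F.functor.obj c.rep ⟶ F'.functor.obj c.rep)) :=
    { toFun := fun θ c => θ.app c.rep
      map_add' := fun _ _ => rfl
      map_smul' := fun _ _ => rfl }
  refine Module.Finite.of_injective T ?_
  rw [injective_iff_map_eq_zero]
  intro θ hθ
  exact natTrans_eq_zero θ fun c => congrFun hθ c

/-- The summands of the inner product depend only on the isomorphism class. -/
lemma scale_mul_ip_iso {F F' : StarFunctor H K} (θ θ' : F.functor ⟶ F'.functor) {x y : H}
    (hx : IsSimple x) (e : x ≅ y) :
    scale x = scale y ∧ ip (θ.app x) (θ'.app x) = ip (θ.app y) (θ'.app y) := by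
  obtain ⟨c, hc⟩ := hx.exists_smul (e.hom ≫ dag e.hom)
  have hc' : dag e.hom ≫ e.hom = c • 𝟙 y := by
    have h : e.hom ≫ dag e.hom ≫ e.hom = e.hom ≫ (c • 𝟙 y) := by
      rw [← Category.assoc, ← hc]
      simp
    exact (cancel_epi e.hom).mp h
  have he : e.hom ≠ 0 := by
    intro h0
    apply hx.id_ne_zero
    rw [← e.hom_inv_id, h0, Limits.zero_comp]
  have h1 : ip e.hom e.hom = c * scale x := by
    have := ip_comp_left (𝟙 x) e.hom e.hom
    rwa [Category.id_comp, ← hc, ip_smul_right] at this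
  have h2 : ip e.hom e.hom = c * scale y := by
    have := ip_comp_right e.hom (𝟙 y) e.hom
    rwa [Category.comp_id, hc', ip_smul_right] at this
  have hc0 : c ≠ 0 := by
    rintro rfl
    exact he (ip_definite _ (by rw [h1, zero_mul]))
  refine ⟨mul_left_cancel₀ hc0 (h1.symm.trans h2), mul_left_cancel₀ hc0 ?_⟩
  have h3 : ip (θ.app x ≫ F'.functor.map e.hom) (θ'.app x ≫ F'.functor.map e.hom) =
      c * ip (θ.app x) (θ'.app x) := by
    rw [ip_comp_left, Category.assoc, ← F'.map_dag, ← Functor.map_comp, ← hc, Functor.map_smul,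
      CategoryTheory.Functor.map_id, Linear.comp_smul, Category.comp_id, ip_smul_right]
  rw [← h3, ← θ.naturality, ← θ'.naturality, ip_comp_right, ← Category.assoc, ← F.map_dag,
    ← Functor.map_comp, hc', Functor.map_smul, CategoryTheory.Functor.map_id, Linear.smul_comp,
    Category.id_comp, ip_smul_right]

end NatInner

section EvenHanded

lemma ip_ext {H : TwoHilb.{v, u}} {x y : H} {a b : x ⟶ y} (h : ∀ f, ip a f = ip b f) : a = b := by
  rw [← sub_eq_zero]
  apply ip_definite
  have h' (f) : ip (a - b) f = 0 := by
    have := ip_add_left a ((-1 : ℂ) • b) f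
    rw [ip_smul_left, h f] at this
    rw [show a - b = a + (-1 : ℂ) • b by module, this]
    simp
  exact h' _

variable {H K : TwoHilb.{v, u}}

/-- The Hilbert space adjoint `φ*` of a linear map between hom-spaces. -/
noncomputable def homAdjoint {x y : H} {x' y' : K} (φ : (x ⟶ y) →ₗ[ℂ] (x' ⟶ y')) :
    (x' ⟶ y') →ₗ[ℂ] (x ⟶ y) :=
  letI := homNormed x y
  letI := homInner x y
  letI := homNormed x' y'
  letI := homInner x' y'
  haveI : FiniteDimensional ℂ (x ⟶ y) := HStarCategory.finite_hom x y
  haveI : FiniteDimensional ℂ (x' ⟶ y') := HStarCategory.finite_hom x' y'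
  LinearMap.adjoint φ

lemma ip_homAdjoint {x y : H} {x' y' : K} (φ : (x ⟶ y) →ₗ[ℂ] (x' ⟶ y')) (g : x' ⟶ y')
    (f : x ⟶ y) : ip (homAdjoint φ g) f = ip g (φ f) := by
  let := homNormed x y
  let := homInner x y
  let := homNormed x' y'
  let := homInner x' y'
  have : FiniteDimensional ℂ (x ⟶ y) := HStarCategory.finite_hom x y
  have : FiniteDimensional ℂ (x' ⟶ y') := HStarCategory.finite_hom x' y'
  exact LinearMap.adjoint_inner_left φ f g

/-- The adjunction isomorphism `φ : Hom(F x, y) → Hom(x, R y)` as a linear equivalence. -/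
def homLinearEquiv {F : StarFunctor H K} {R : StarFunctor K H} (adj : F.functor ⊣ R.functor)
    (x : H) (y : K) : (F.functor.obj x ⟶ y) ≃ₗ[ℂ] (x ⟶ R.functor.obj y) where
  toEquiv := adj.homEquiv x y
  map_add' f g := by simp [Adjunction.homEquiv_unit]
  map_smul' c f := by simp [Adjunction.homEquiv_unit]

/-- The isomorphism `* φ* * : Hom(R y, x) → Hom(y, F x)`. -/
noncomputable def evenHandedHom {F : StarFunctor H K} {R : StarFunctor K H}
    (adj : F.functor ⊣ R.functor) (x : H) (y : K) (g : R.functor.obj y ⟶ x) :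
    y ⟶ F.functor.obj x :=
  dag (homAdjoint (homLinearEquiv adj x y).toLinearMap (dag g))

lemma ip_evenHandedHom {F : StarFunctor H K} {R : StarFunctor K H}
    (adj : F.functor ⊣ R.functor) {x : H} {y : K} (g : R.functor.obj y ⟶ x)
    (f : F.functor.obj x ⟶ y) :
    ip (dag (evenHandedHom adj x y g)) f = ip (dag g) (adj.homEquiv x y f) := by
  rw [evenHandedHom, dag, dag, HStarCategory.dag_dag, ip_homAdjoint]
  rfl

/-- `* φ* *` is bijective. -/
noncomputable def evenHandedEquiv {F : StarFunctor H K} {R : StarFunctor K H}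
    (adj : F.functor ⊣ R.functor) (x : H) (y : K) :
    (R.functor.obj y ⟶ x) ≃ (y ⟶ F.functor.obj x) where
  toFun := evenHandedHom adj x y
  invFun k := dag (homAdjoint (homLinearEquiv adj x y).symm.toLinearMap (dag k))
  left_inv g := by
    have h : homAdjoint (homLinearEquiv adj x y).symm.toLinearMap
        (dag (evenHandedHom adj x y g)) = dag g := by
      apply ip_ext
      intro f
      rw [ip_homAdjoint, ip_evenHandedHom]
      exact congrArg (ip (dag g)) ((homLinearEquiv adj x y).apply_symm_apply f)
    change dag _ = g
    rw [h, dag, HStarCategory.dag_dag]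
  right_inv k := by
    have h : dag (evenHandedHom adj x y
        (dag (homAdjoint (homLinearEquiv adj x y).symm.toLinearMap (dag k)))) = dag k := by
      apply ip_ext
      intro f
      rw [ip_evenHandedHom, dag, dag, dag, HStarCategory.dag_dag, ip_homAdjoint]
      exact congrArg (ip (dag k)) ((homLinearEquiv adj x y).symm_apply_apply f)
    have := congrArg dag h
    simpa only [dag, HStarCategory.dag_dag] using this

/-- The canonical even-handed structure `Ψ` on 2-Hilbert spaces: it turns `R` as a right adjoint of
`F`, with adjunction isomorphisms `φ : Hom(F x, y) → Hom(x, R y)`, into a left adjoint of `F`, with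
adjunction isomorphisms `Ψ(φ) = * φ* * : Hom(R y, x) → Hom(y, F x)`. -/
noncomputable def Psi {F : StarFunctor H K} {R : StarFunctor K H}
    (adj : F.functor ⊣ R.functor) : R.functor ⊣ F.functor :=
  Adjunction.mkOfHomEquiv
    { homEquiv := fun y x => evenHandedEquiv adj x y
      homEquiv_naturality_left_symm := by
        intro y' y x f k
        rw [Equiv.symm_apply_eq]
        obtain ⟨g, rfl⟩ := (evenHandedEquiv adj x y).surjective k
        rw [Equiv.symm_apply_apply]
        change f ≫ evenHandedHom adj x y g = evenHandedHom adj x y' (R.functor.map f ≫ g)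
        have h : dag (f ≫ evenHandedHom adj x y g) =
            dag (evenHandedHom adj x y' (R.functor.map f ≫ g)) := by
          apply ip_ext
          intro l
          rw [ip_evenHandedHom, dag, dag, HStarCategory.dag_comp, HStarCategory.dag_comp,
            ip_comp_left, ip_comp_left, dag, dag, HStarCategory.dag_dag, HStarCategory.dag_dag,
            ip_evenHandedHom, Adjunction.homEquiv_naturality_right]
        have := congrArg dag h
        simpa only [dag, HStarCategory.dag_dag] using this
      homEquiv_naturality_right := by
        intro y x x' g k
        change evenHandedHom adj x' y (g ≫ k) = evenHandedHom adj x y g ≫ F.functor.map k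
        have h : dag (evenHandedHom adj x' y (g ≫ k)) =
            dag (evenHandedHom adj x y g ≫ F.functor.map k) := by
          apply ip_ext
          intro l
          rw [ip_evenHandedHom, dag, dag, HStarCategory.dag_comp, HStarCategory.dag_comp,
            ip_comp_right, ip_comp_right, dag, dag, HStarCategory.dag_dag, HStarCategory.dag_dag,
            ip_evenHandedHom, Adjunction.homEquiv_naturality_left]
        have := congrArg dag h
        simpa only [dag, HStarCategory.dag_dag] using this }

/-- A right adjoint of `F` in the 2-category of 2-Hilbert spaces: a linear `*`-functor with a unit
and a counit satisfying the triangle equations. -/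
structure RightAdjoint (F : StarFunctor H K) where
  functor : StarFunctor K H
  adj : F.functor ⊣ functor.functor

end EvenHanded

/-- A unitary 2-representation of `G`: a 2-Hilbert space `H`, unitary linear `*`-functors
`α_g : H → H`, and coherent unitary natural isomorphisms `a(e) : id ⇒ α_e` and
`a(g₂, g₁) : α_{g₂} ∘ α_{g₁} ⇒ α_{g₂ g₁}`. The isomorphism `a(g₂, g₁)` is `mult g₂ g₁ g h` where
`h` is a proof of `g₂ * g₁ = g`. -/
structure TwoRep (G : Type w) [Group G] where
  space : TwoHilb.{v, u}
  act : G → StarFunctor space space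
  act_unitary (g : G) : (act g).IsUnitary
  unit : 𝟭 space ≅ (act 1).functor
  unit_unitary (x : space) : IsUnitaryHom (unit.hom.app x)
  mult (g₂ g₁ g : G) (h : g₂ * g₁ = g) : (act g₁).functor ⋙ (act g₂).functor ≅ (act g).functor
  mult_unitary (g₂ g₁ g : G) (h : g₂ * g₁ = g) (x : space) :
    IsUnitaryHom ((mult g₂ g₁ g h).hom.app x)
  one_mult (g : G) (x : space) :
    unit.hom.app ((act g).functor.obj x) ≫ (mult 1 g g (one_mul g)).hom.app x = 𝟙 _
  mult_one (g : G) (x : space) :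
    (act g).functor.map (unit.hom.app x) ≫ (mult g 1 g (mul_one g)).hom.app x = 𝟙 _
  mult_assoc (g₃ g₂ g₁ g₃₂ g₂₁ g : G) (h₃₂ : g₃ * g₂ = g₃₂) (h₂₁ : g₂ * g₁ = g₂₁)
    (h : g₃₂ * g₁ = g) (h' : g₃ * g₂₁ = g) (x : space) :
    (mult g₃ g₂ g₃₂ h₃₂).hom.app ((act g₁).functor.obj x) ≫ (mult g₃₂ g₁ g h).hom.app x =
      (act g₃).functor.map ((mult g₂ g₁ g₂₁ h₂₁).hom.app x) ≫ (mult g₃ g₂₁ g h').hom.app x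

namespace TwoRep

variable {G : Type w} [Group G]

/-- The functor `α_g`. -/
abbrev fn (α : TwoRep.{v, u} G) (g : G) : α.space ⥤ α.space := (α.act g).functor

/-- A morphism of unitary 2-representations: a linear `*`-functor `σ` with coherent unitary natural
isomorphisms `σ(g) : β_g ∘ σ ⇒ σ ∘ α_g`. -/
structure Hom (α β : TwoRep.{v, u} G) where
  toStar : StarFunctor α.space β.space
  nat (g : G) : toStar.functor ⋙ β.fn g ≅ α.fn g ⋙ toStar.functor
  nat_unitary (g : G) (x : α.space) : IsUnitaryHom ((nat g).hom.app x)
  nat_mult (g₂ g₁ g : G) (h : g₂ * g₁ = g) (x : α.space) :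
    (β.mult g₂ g₁ g h).hom.app (toStar.functor.obj x) ≫ (nat g).hom.app x =
      (β.fn g₂).map ((nat g₁).hom.app x) ≫ (nat g₂).hom.app ((α.fn g₁).obj x) ≫
        toStar.functor.map ((α.mult g₂ g₁ g h).hom.app x)
  nat_unit (x : α.space) :
    β.unit.hom.app (toStar.functor.obj x) ≫ (nat 1).hom.app x =
      toStar.functor.map (α.unit.hom.app x)

/-- The underlying functor of a morphism. -/
abbrev Hom.fn {α β : TwoRep.{v, u} G} (σ : Hom α β) : α.space ⥤ β.space := σ.toStar.functor

/-- A 2-morphism between morphisms of unitary 2-representations: a modification. -/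
@[ext] structure Hom₂ {α β : TwoRep.{v, u} G} (σ ρ : Hom α β) where
  toNat : σ.fn ⟶ ρ.fn
  comm (g : G) (x : α.space) :
    (σ.nat g).hom.app x ≫ toNat.app ((α.fn g).obj x) =
      (β.fn g).map (toNat.app x) ≫ (ρ.nat g).hom.app x

/-- The identity morphism. -/
def Hom.id (α : TwoRep.{v, u} G) : Hom α α where
  toStar := StarFunctor.id α.space
  nat g := NatIso.ofComponents (fun x => Iso.refl ((α.fn g).obj x))
  nat_unitary g x := IsUnitaryHom.id ((α.fn g).obj x)
  nat_mult g₂ g₁ g h x := by simp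
  nat_unit x := by simp

/-- Composition of morphisms (`σ` first, then `τ`); its coherence isomorphisms are
`τ(σ(g)) ∘ τ(g)_σ`. -/
def Hom.comp {α β γ : TwoRep.{v, u} G} (σ : Hom α β) (τ : Hom β γ) : Hom α γ where
  toStar := σ.toStar.comp τ.toStar
  nat g := NatIso.ofComponents
    (fun x => (τ.nat g).app (σ.fn.obj x) ≪≫ τ.fn.mapIso ((σ.nat g).app x))
    (by
      intro x y f
      have h1 := (τ.nat g).hom.naturality (σ.fn.map f)
      have h2 := congrArg τ.fn.map ((σ.nat g).hom.naturality f)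
      simp only [Functor.map_comp, Functor.comp_map] at h1 h2
      simp [reassoc_of% h1, h2])
  nat_unitary g x :=
    (τ.nat_unitary g (σ.fn.obj x)).comp (τ.toStar.map_unitary (σ.nat_unitary g x))
  nat_mult g₂ g₁ g h x := by
    have h1 := τ.nat_mult g₂ g₁ g h (σ.fn.obj x)
    have h2 := congrArg τ.fn.map (σ.nat_mult g₂ g₁ g h x)
    have h3 := (τ.nat g₂).hom.naturality ((σ.nat g₁).hom.app x)
    simp only [Functor.map_comp, Functor.comp_map] at h2 h3
    simp [reassoc_of% h1, h2, reassoc_of% h3]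
  nat_unit x := by
    have h1 := τ.nat_unit (σ.fn.obj x)
    have h2 := congrArg τ.fn.map (σ.nat_unit x)
    simp only [Functor.map_comp] at h2
    simp [reassoc_of% h1, h2]

@[simp] lemma Hom.id_obj (α : TwoRep.{v, u} G) (x : α.space) :
    (Hom.id α).toStar.functor.obj x = x := rfl

@[simp] lemma Hom.id_map (α : TwoRep.{v, u} G) {x y : α.space} (f : x ⟶ y) :
    (Hom.id α).toStar.functor.map f = f := rfl

@[simp] lemma Hom.id_nat (α : TwoRep.{v, u} G) (g : G) (x : α.space) :
    ((Hom.id α).nat g).hom.app x = 𝟙 ((α.fn g).obj x) := rfl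

section
variable {α β γ : TwoRep.{v, u} G} (σ : Hom α β) (τ : Hom β γ)

@[simp] lemma Hom.comp_obj (x : α.space) :
    (σ.comp τ).toStar.functor.obj x = τ.fn.obj (σ.fn.obj x) := rfl

@[simp] lemma Hom.comp_map {x y : α.space} (f : x ⟶ y) :
    (σ.comp τ).toStar.functor.map f = τ.fn.map (σ.fn.map f) := rfl

@[simp] lemma Hom.comp_nat (g : G) (x : α.space) : ((σ.comp τ).nat g).hom.app x =
    (τ.nat g).hom.app (σ.fn.obj x) ≫ τ.fn.map ((σ.nat g).hom.app x) := rfl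

end

instance {α β : TwoRep.{v, u} G} : Category (Hom α β) where
  Hom σ ρ := Hom₂ σ ρ
  id σ := { toNat := 𝟙 _, comm := by intros; simp }
  comp θ θ' :=
    { toNat := θ.toNat ≫ θ'.toNat
      comm := by
        intro g x
        rw [NatTrans.comp_app, NatTrans.comp_app, ← Category.assoc, θ.comm, Category.assoc,
          θ'.comm, Functor.map_comp, Category.assoc] }
  id_comp _ := Hom₂.ext (Category.id_comp _)
  comp_id _ := Hom₂.ext (Category.comp_id _)
  assoc _ _ _ := Hom₂.ext (Category.assoc _ _ _)

@[simp] lemma Hom₂.id_app {α β : TwoRep.{v, u} G} (σ : Hom α β) (x : α.space) :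
    (Hom₂.toNat (𝟙 σ)).app x = 𝟙 (σ.fn.obj x) := rfl

@[simp] lemma Hom₂.comp_app {α β : TwoRep.{v, u} G} {σ ρ τ : Hom α β} (θ : σ ⟶ ρ)
    (θ' : ρ ⟶ τ) (x : α.space) :
    (Hom₂.toNat (θ ≫ θ')).app x = (Hom₂.toNat θ).app x ≫ (Hom₂.toNat θ').app x := rfl

lemma Hom₂.hom_ext {α β : TwoRep.{v, u} G} {σ ρ : Hom α β} {θ θ' : σ ⟶ ρ}
    (h : ∀ x, (Hom₂.toNat θ).app x = (Hom₂.toNat θ').app x) : θ = θ' :=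
  Hom₂.ext (NatTrans.ext (funext h))

/-- A natural isomorphism which is a modification is an invertible 2-morphism. -/
def Hom.isoMk {α β : TwoRep.{v, u} G} {σ ρ : Hom α β} (e : σ.fn ≅ ρ.fn)
    (comm : ∀ g x, (σ.nat g).hom.app x ≫ e.hom.app ((α.fn g).obj x) =
      (β.fn g).map (e.hom.app x) ≫ (ρ.nat g).hom.app x) : σ ≅ ρ where
  hom := ⟨e.hom, comm⟩
  inv := ⟨e.inv, by
    intro g x
    rw [← cancel_epi ((β.fn g).map (e.hom.app x)), ← reassoc_of% (comm g x),
      ← Functor.map_comp_assoc]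
    simp⟩
  hom_inv_id := Hom₂.ext e.hom_inv_id
  inv_hom_id := Hom₂.ext e.inv_hom_id

/-- The 2-category of unitary 2-representations of `G`. -/
instance : Bicategory (TwoRep.{v, u} G) where
  Hom α β := Hom α β
  id α := Hom.id α
  comp σ τ := Hom.comp σ τ
  homCategory _ _ := inferInstance
  whiskerLeft {α β γ} σ {τ τ'} θ :=
    { toNat := Functor.whiskerLeft (Hom.fn σ) (Hom₂.toNat θ)
      comm := by
        intro g x
        have h1 := Hom₂.comm θ g ((Hom.fn σ).obj x)
        have h2 := (Hom₂.toNat θ).naturality ((Hom.nat σ g).hom.app x)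
        exact (Category.assoc _ _ _).trans ((congrArg (fun k => _ ≫ k) h2).trans
          ((Category.assoc _ _ _).symm.trans ((congrArg (fun k => k ≫ _) h1).trans
            (Category.assoc _ _ _)))) }
  whiskerRight {α β γ} {σ σ'} θ τ :=
    { toNat := Functor.whiskerRight (Hom₂.toNat θ) (Hom.fn τ)
      comm := by
        intro g x
        have h1 := congrArg (Hom.fn τ).map (Hom₂.comm θ g x)
        have h2 := (Hom.nat τ g).hom.naturality ((Hom₂.toNat θ).app x)
        simp only [Functor.map_comp, Functor.comp_map] at h1 h2
        simp [h1, reassoc_of% h2] }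
  associator σ τ υ := Hom.isoMk
    (Functor.associator (Hom.fn σ) (Hom.fn τ) (Hom.fn υ)) (by intro g x; simp)
  leftUnitor σ := Hom.isoMk (Functor.leftUnitor (Hom.fn σ)) (by intro g x; simp)
  rightUnitor σ := Hom.isoMk (Functor.rightUnitor (Hom.fn σ)) (by intro g x; simp)
  whiskerLeft_id σ τ := Hom₂.hom_ext fun x => rfl
  whiskerLeft_comp σ _ _ _ θ θ' := Hom₂.hom_ext fun x => rfl
  id_whiskerLeft θ := Hom₂.hom_ext fun x => by simp [Hom.isoMk]
  comp_whiskerLeft _ _ _ _ _ := Hom₂.hom_ext fun x =>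
    ((Category.id_comp _).trans (Category.comp_id _)).symm
  id_whiskerRight _ _ := Hom₂.hom_ext fun x => by simp
  comp_whiskerRight _ _ _ := Hom₂.hom_ext fun x => by simp
  whiskerRight_id θ := Hom₂.hom_ext fun x => by simp [Hom.isoMk]
  whiskerRight_comp _ _ _ := Hom₂.hom_ext fun x =>
    ((Category.id_comp _).trans (Category.comp_id _)).symm
  whisker_assoc _ _ _ _ _ := Hom₂.hom_ext fun x =>
    ((Category.id_comp _).trans (Category.comp_id _)).symm
  whisker_exchange _ _ := Hom₂.hom_ext fun x => by simp
  pentagon _ _ _ _ := Hom₂.hom_ext fun x => by simp [Hom.isoMk]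
  triangle _ _ := Hom₂.hom_ext fun x => by simp [Hom.isoMk]

end TwoRep

/-- The Grothendieck category `[B]` of a 2-category: it has the same objects as `B`, and its
morphisms are the isomorphism classes of 1-morphisms of `B`. -/
structure GrothendieckCat (B : Type*) where
  of : B

namespace GrothendieckCat

variable {B : Type*} [Bicategory B]

/-- The isomorphism classes of 1-morphisms. -/
def Hom (a b : GrothendieckCat B) : Type _ := Quotient (isIsomorphicSetoid (a.of ⟶ b.of))

/-- The isomorphism class of a 1-morphism. -/
def cls {a b : B} (f : a ⟶ b) : Hom (GrothendieckCat.mk a) (GrothendieckCat.mk b) :=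
  Quotient.mk (isIsomorphicSetoid (a ⟶ b)) f

instance : Category (GrothendieckCat B) where
  Hom a b := Hom a b
  id a := cls (𝟙 a.of)
  comp {a b c} p q := Quotient.map₂ (sa := isIsomorphicSetoid (a.of ⟶ b.of))
    (sb := isIsomorphicSetoid (b.of ⟶ c.of)) (sc := isIsomorphicSetoid (a.of ⟶ c.of))
    (fun f g => f ≫ g)
    (fun _ _ ⟨e⟩ _ _ ⟨e'⟩ =>
      ⟨Bicategory.whiskerRightIso e _ ≪≫ Bicategory.whiskerLeftIso _ e'⟩) p q
  id_comp := by
    rintro a b ⟨f⟩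
    exact Quotient.sound (s := isIsomorphicSetoid (a.of ⟶ b.of)) ⟨Bicategory.leftUnitor f⟩
  comp_id := by
    rintro a b ⟨f⟩
    exact Quotient.sound (s := isIsomorphicSetoid (a.of ⟶ b.of)) ⟨Bicategory.rightUnitor f⟩
  assoc := by
    rintro a b c d ⟨f⟩ ⟨g⟩ ⟨h⟩
    exact Quotient.sound (s := isIsomorphicSetoid (a.of ⟶ d.of)) ⟨Bicategory.associator f g h⟩

end GrothendieckCat

/-- Finite-dimensional Hilbert spaces. -/
structure FdHilb : Type (w + 1) where
  carrier : Type w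
  [normed : NormedAddCommGroup carrier]
  [innerProduct : InnerProductSpace ℂ carrier]
  [finite : FiniteDimensional ℂ carrier]

namespace FdHilb

attribute [instance] FdHilb.normed FdHilb.innerProduct FdHilb.finite

/-- The category of finite-dimensional Hilbert spaces and linear maps. -/
instance : Category FdHilb.{w} where
  Hom V W := V.carrier →ₗ[ℂ] W.carrier
  id V := LinearMap.id
  comp f g := g ∘ₗ f

/-- A linear map between Hilbert spaces is unitary if it is bijective and preserves inner
products. -/
def IsUnitary {V W : FdHilb.{w}} (f : V.carrier →ₗ[ℂ] W.carrier) : Prop :=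
  Function.Bijective f ∧ ∀ v v' : V.carrier, inner ℂ (f v) (f v') = inner ℂ v v'

end FdHilb

/-- The loop groupoid of `G`: its objects are the elements of `G`, and a morphism `g → g'` is an
element `h` of `G` with `h g h⁻¹ = g'`. -/
structure LoopGroupoid (G : Type w) where
  elt : G

namespace LoopGroupoid

variable {G : Type w} [Group G]

instance : Category (LoopGroupoid G) where
  Hom g g' := {h : G // h * g.elt * h⁻¹ = g'.elt}
  id g := ⟨1, by simp⟩
  comp h₁ h₂ := ⟨h₂.1 * h₁.1, by
    refine Eq.trans ?_ h₂.2
    refine Eq.trans ?_ (congrArg (fun k => h₂.1 * k * h₂.1⁻¹) h₁.2)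
    group⟩
  id_comp _ := Subtype.ext (mul_one _)
  comp_id _ := Subtype.ext (one_mul _)
  assoc _ _ _ := Subtype.ext (mul_assoc _ _ _).symm

end LoopGroupoid

/-- The category `Hilb_G(G)` of unitary equivariant vector bundles over `G`: functors from the loop
groupoid to finite-dimensional Hilbert spaces which send all morphisms to unitary maps, and natural
transformations. -/
abbrev HilbG (G : Type w) [Group G] :=
  ObjectProperty.FullSubcategory (C := LoopGroupoid G ⥤ FdHilb.{u})
    (fun V => ∀ (g g' : LoopGroupoid G) (h : g ⟶ g'), FdHilb.IsUnitary (V.map h))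

/-- The 2-trace `Nat(id, F)` of a linear `*`-endofunctor of a 2-Hilbert space. -/
noncomputable def twoTrace {H : TwoHilb.{v, u}} (F : StarFunctor H H) : FdHilb.{max u v} where
  carrier := 𝟭 H ⟶ F.functor
  normed := (natCore (StarFunctor.id H) F).toNormedAddCommGroup
  innerProduct := InnerProductSpace.ofCore (natCore (StarFunctor.id H) F).toCore
  finite := finite_nat (StarFunctor.id H) F

section Character

variable {G : Type w} [Group G]

/-- Conjugation of a natural transformation `θ : id ⇒ α_g` by `h`, for `h g h⁻¹ = g'`: the composite
`id ⇒ α_e ⇒ α_h α_{h⁻¹} ⇒ α_h α_g α_{h⁻¹} ⇒ α_{h g} α_{h⁻¹} ⇒ α_{g'}`. -/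
@[simps] def conjNat (α : TwoRep.{v, u} G) {g g' : G} (h : G) (e : h * g * h⁻¹ = g')
    (θ : 𝟭 α.space ⟶ α.fn g) : 𝟭 α.space ⟶ α.fn g' where
  app x := α.unit.hom.app x ≫ (α.mult h h⁻¹ 1 (mul_inv_cancel h)).inv.app x ≫
    (α.fn h).map (θ.app ((α.fn h⁻¹).obj x)) ≫
    (α.mult h g (h * g) rfl).hom.app ((α.fn h⁻¹).obj x) ≫
    (α.mult (h * g) h⁻¹ g' e).hom.app x
  naturality x y f := by
    have h1 := α.unit.hom.naturality f
    have h2 := (α.mult h h⁻¹ 1 (mul_inv_cancel h)).inv.naturality f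
    have h3 := congrArg (α.fn h).map (θ.naturality ((α.fn h⁻¹).map f))
    have h4 := (α.mult h g (h * g) rfl).hom.naturality ((α.fn h⁻¹).map f)
    have h5 := (α.mult (h * g) h⁻¹ g' e).hom.naturality f
    simp only [Functor.comp_map, Functor.id_map, Functor.map_comp] at h1 h2 h3 h4 h5
    simp only [Functor.id_map, Category.assoc, ← h5, ← reassoc_of% h4, ← reassoc_of% h3,
      ← reassoc_of% h2, ← reassoc_of% h1]

lemma conjNat_spec (α : TwoRep.{v, u} G) {g g' : G} (h : G) (e : h * g * h⁻¹ = g')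
    (θ : 𝟭 α.space ⟶ α.fn g) (k : G) (hk : h * g = k) (hk' : g' * h = k) (x : α.space) :
    (conjNat α h e θ).app ((α.fn h).obj x) ≫ (α.mult g' h k hk').hom.app x =
      (α.fn h).map (θ.app x) ≫ (α.mult h g k hk).hom.app x := by
  subst hk
  have a1 := α.mult_assoc (h * g) h⁻¹ h g' 1 (h * g) e (inv_mul_cancel h) hk' (mul_one _) x
  have a2 := (α.mult h g (h * g) rfl).hom.naturality ((α.mult h⁻¹ h 1 (inv_mul_cancel h)).hom.app x)
  have a3 := congrArg (α.fn h).map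
    (θ.naturality ((α.mult h⁻¹ h 1 (inv_mul_cancel h)).hom.app x))
  have a4 := α.mult_assoc h h⁻¹ h 1 1 h (mul_inv_cancel h) (inv_mul_cancel h) (one_mul h)
    (mul_one h) x
  have a5 := α.one_mult h x
  have a6 := α.mult_one h x
  have a7 := congrArg (α.fn h).map (θ.naturality (α.unit.hom.app x))
  have a8 := (α.mult h g (h * g) rfl).hom.naturality (α.unit.hom.app x)
  have a9 := α.mult_one (h * g) x
  simp only [Functor.comp_map, Functor.id_map, Functor.map_comp, Functor.comp_obj,
    Functor.id_obj] at a2 a3 a7 a8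
  have b1 : α.unit.hom.app ((α.fn h).obj x) ≫
      (α.mult h h⁻¹ 1 (mul_inv_cancel h)).inv.app ((α.fn h).obj x) ≫
      (α.fn h).map ((α.mult h⁻¹ h 1 (inv_mul_cancel h)).hom.app x) =
      (α.fn h).map (α.unit.hom.app x) := by
    rw [← cancel_mono ((α.mult h 1 h (mul_one h)).hom.app x)]
    simp only [Category.assoc]
    rw [← a4, Iso.inv_hom_id_app_assoc, a5, a6]
    rfl
  simp only [conjNat_app, Category.assoc]
  rw [a1, ← reassoc_of% a2, ← reassoc_of% a3, reassoc_of% b1, reassoc_of% a7]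
  rw [reassoc_of% a8]
  refine (congrArg (fun k => (α.fn h).map (θ.app x) ≫
    (α.mult h g (h * g) rfl).hom.app x ≫ k) a9).trans ?_
  exact congrArg (fun k => (α.fn h).map (θ.app x) ≫ k) (Category.comp_id _)

lemma eq_conjNat (α : TwoRep.{v, u} G) {g g' : G} (h : G) (e : h * g * h⁻¹ = g')
    (θ : 𝟭 α.space ⟶ α.fn g) (k : G) (hk : h * g = k) (hk' : g' * h = k)
    (θ' : 𝟭 α.space ⟶ α.fn g')
    (H : ∀ x, θ'.app ((α.fn h).obj x) ≫ (α.mult g' h k hk').hom.app x =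
      (α.fn h).map (θ.app x) ≫ (α.mult h g k hk).hom.app x) : θ' = conjNat α h e θ := by
  have H' (x : α.space) : θ'.app ((α.fn h).obj x) = (conjNat α h e θ).app ((α.fn h).obj x) := by
    rw [← cancel_mono ((α.mult g' h k hk').hom.app x), H, conjNat_spec]
  ext y
  let f : y ⟶ (α.fn h).obj ((α.fn h⁻¹).obj y) :=
    α.unit.hom.app y ≫ (α.mult h h⁻¹ 1 (mul_inv_cancel h)).inv.app y
  have : IsIso f := inferInstance
  have h1 := θ'.naturality f
  have h2 := (conjNat α h e θ).naturality f
  rw [H', h2] at h1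
  exact ((cancel_mono ((α.fn g').map f)).mp h1).symm

lemma conjNat_conjNat (α : TwoRep.{v, u} G) {g g' g'' : G} (h₁ h₂ : G)
    (e₁ : h₁ * g * h₁⁻¹ = g') (e₂ : h₂ * g' * h₂⁻¹ = g'')
    (e : h₂ * h₁ * g * (h₂ * h₁)⁻¹ = g'') (θ : 𝟭 α.space ⟶ α.fn g) :
    conjNat α h₂ e₂ (conjNat α h₁ e₁ θ) = conjNat α (h₂ * h₁) e θ := by
  have k₁ : g' * h₁ = h₁ * g := by rw [← e₁]; group
  have k₂ : g'' * h₂ = h₂ * g' := by rw [← e₂]; group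
  have k₃ : g'' * (h₂ * h₁) = h₂ * h₁ * g := by rw [← e]; group
  refine eq_conjNat α _ e θ (h₂ * h₁ * g) rfl k₃ _ fun x => ?_
  have s₁ := congrArg (α.fn h₂).map (conjNat_spec α h₁ e₁ θ (h₁ * g) rfl k₁ x)
  have s₂ := conjNat_spec α h₂ e₂ (conjNat α h₁ e₁ θ) (h₂ * g') rfl k₂ ((α.fn h₁).obj x)
  have n₁ := (conjNat α h₂ e₂ (conjNat α h₁ e₁ θ)).naturality
    ((α.mult h₂ h₁ (h₂ * h₁) rfl).hom.app x)
  have m₁ := α.mult_assoc g'' h₂ h₁ (h₂ * g') (h₂ * h₁) (h₂ * h₁ * g) k₂ rfl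
    (by rw [mul_assoc, k₁, mul_assoc]) k₃ x
  have m₂ := α.mult_assoc h₂ g' h₁ (h₂ * g') (h₁ * g) (h₂ * h₁ * g) rfl k₁
    (by rw [mul_assoc, k₁, mul_assoc]) (mul_assoc _ _ _).symm x
  have m₃ := α.mult_assoc h₂ h₁ g (h₂ * h₁) (h₁ * g) (h₂ * h₁ * g) rfl rfl rfl
    (mul_assoc _ _ _).symm x
  have n₂ := (α.mult h₂ h₁ (h₂ * h₁) rfl).hom.naturality (θ.app x)
  simp only [Functor.comp_map, Functor.id_map, Functor.map_comp, Functor.comp_obj,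
    Functor.id_obj] at s₁ n₁ n₂
  rw [← cancel_epi ((α.mult h₂ h₁ (h₂ * h₁) rfl).hom.app x), reassoc_of% n₁, ← m₁,
    reassoc_of% s₂, m₂, reassoc_of% s₁, ← m₃, reassoc_of% n₂]

lemma conjNat_one (α : TwoRep.{v, u} G) {g : G} (e : 1 * g * 1⁻¹ = g)
    (θ : 𝟭 α.space ⟶ α.fn g) : conjNat α 1 e θ = θ := by
  symm
  refine eq_conjNat α 1 e θ g (one_mul g) (mul_one g) θ fun x => ?_
  have n₁ := θ.naturality (α.unit.hom.app x)
  have n₂ := α.unit.hom.naturality (θ.app x)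
  have o₁ := α.mult_one g x
  have o₂ := α.one_mult g x
  simp only [Functor.id_map, Functor.id_obj] at n₁ n₂
  rw [← cancel_epi (α.unit.hom.app x), reassoc_of% n₁, o₁, ← reassoc_of% n₂, o₂]
  rfl

/-- Conjugation as a linear map. -/
@[simps] def conjLin (α : TwoRep.{v, u} G) {g g' : G} (h : G) (e : h * g * h⁻¹ = g') :
    (𝟭 α.space ⟶ α.fn g) →ₗ[ℂ] (𝟭 α.space ⟶ α.fn g') where
  toFun := conjNat α h e
  map_add' θ θ' := by
    ext x
    simp [Functor.map_add]
  map_smul' c θ := by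
    ext x
    simp [Functor.map_smul]

lemma map_injective (α : TwoRep.{v, u} G) (h : G) {x y : α.space} {f f' : x ⟶ y}
    (H : (α.fn h).map f = (α.fn h).map f') : f = f' := by
  apply ip_ext
  intro k
  rw [← (α.act_unitary h x y).1, ← (α.act_unitary h x y).1]
  exact congrArg (fun l => ip l ((α.fn h).map k)) H

lemma IsSimple.map (α : TwoRep.{v, u} G) (h : G) {x : α.space} (hx : IsSimple x) :
    IsSimple ((α.fn h).obj x) := by
  let T : (x ⟶ x) →ₗ[ℂ] ((α.fn h).obj x ⟶ (α.fn h).obj x) := (α.fn h).mapLinearMap ℂ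
  have hT : Function.Bijective T :=
    ⟨fun f f' H => map_injective α h H, (α.act_unitary h x x).2⟩
  rw [IsSimple, ← (LinearEquiv.ofBijective T hT).finrank_eq]
  exact hx

lemma scale_map (α : TwoRep.{v, u} G) (h : G) (x : α.space) :
    scale ((α.fn h).obj x) = scale x := by
  have := (α.act_unitary h x x).1 (𝟙 x) (𝟙 x)
  rwa [CategoryTheory.Functor.map_id] at this

/-- The permutation of the isomorphism classes of simple objects given by `α_h`. -/
noncomputable def simplePerm (α : TwoRep.{v, u} G) (h : G) (c : SimpleClass α.space) :
    SimpleClass α.space :=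
  SimpleClass.mk ((α.fn h).obj c.rep) (c.isSimple_rep.map α h)

lemma simplePerm_bijective (α : TwoRep.{v, u} G) (h : G) :
    Function.Bijective (simplePerm α h) := by
  refine Finite.injective_iff_bijective.mp fun c c' H => ?_
  obtain ⟨e⟩ := (SimpleClass.mk_eq_iff _ _).mp H
  have e' (c : SimpleClass α.space) : c.rep ≅ (α.fn h⁻¹).obj ((α.fn h).obj c.rep) :=
    α.unit.app c.rep ≪≫ ((α.mult h⁻¹ h 1 (inv_mul_cancel h)).app c.rep).symm
  rw [← c.mk_rep, ← c'.mk_rep]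
  exact (SimpleClass.mk_eq_iff _ _).mpr ⟨e' c ≪≫ (α.fn h⁻¹).mapIso e ≪≫ (e' c').symm⟩

lemma natInner_conjNat (α : TwoRep.{v, u} G) {g g' : G} (h : G) (e : h * g * h⁻¹ = g')
    (θ θ' : 𝟭 α.space ⟶ α.fn g) :
    natInner (F := StarFunctor.id α.space) (F' := α.act g') (conjNat α h e θ) (conjNat α h e θ') =
      natInner (F := StarFunctor.id α.space) (F' := α.act g) θ θ' := by
  have hk' : g' * h = h * g := by rw [← e]; group
  rw [natInner, natInner, ← (simplePerm_bijective α h).sum_comp]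
  refine Finset.sum_congr rfl fun c _ => ?_
  obtain ⟨i⟩ := SimpleClass.rep_iso _ (c.isSimple_rep.map α h)
  have h1 := scale_mul_ip_iso (F := StarFunctor.id α.space) (F' := α.act g') (conjNat α h e θ)
    (conjNat α h e θ') (SimpleClass.isSimple_rep _) i
  refine (congrArg₂ (fun a b => a * b) h1.1 h1.2).trans ?_
  rw [scale_map]
  congr 1
  rw [← ip_comp_unitary_right _ _ _ (α.mult_unitary g' h _ hk' c.rep)]
  refine (congrArg₂ ip (conjNat_spec α h e θ _ rfl hk' c.rep)
    (conjNat_spec α h e θ' _ rfl hk' c.rep)).trans ?_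
  rw [ip_comp_unitary_right _ _ _ (α.mult_unitary h g _ rfl c.rep)]
  exact (α.act_unitary h _ _).1 _ _

lemma conjNat_bijective (α : TwoRep.{v, u} G) {g g' : G} (h : G) (e : h * g * h⁻¹ = g') :
    Function.Bijective (conjNat α h e) := by
  have e' : h⁻¹ * g' * h⁻¹⁻¹ = g := by rw [← e]; group
  have k : h⁻¹ * h * g * (h⁻¹ * h)⁻¹ = g := by group
  have k' : h * h⁻¹ * g' * (h * h⁻¹)⁻¹ = g' := by group
  refine Function.bijective_iff_has_inverse.mpr ⟨conjNat α h⁻¹ e', fun θ => ?_, fun θ => ?_⟩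
  · rw [conjNat_conjNat α _ _ _ _ k]
    simp only [inv_mul_cancel, conjNat_one]
  · rw [conjNat_conjNat α _ _ _ _ k']
    simp only [mul_inv_cancel, conjNat_one]

/-- The 2-character of a unitary 2-representation, as a unitary equivariant vector bundle: its fibre
over `g` is the 2-trace `Nat(id, α_g)`, and `h` acts by conjugation. -/
noncomputable def chi (α : TwoRep.{v, u} G) : HilbG.{max u v} G where
  obj :=
    { obj := fun g => twoTrace (α.act g.elt)
      map := fun h => conjLin α h.1 h.2
      map_id := fun g => LinearMap.ext fun θ => conjNat_one α _ θ
      map_comp := fun h₁ h₂ => LinearMap.ext fun θ =>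
        (conjNat_conjNat α h₁.1 h₂.1 h₁.2 h₂.2 _ θ).symm }
  property := by
    intro g g' h
    exact ⟨conjNat_bijective α h.1 h.2, fun θ θ' => natInner_conjNat α h.1 h.2 θ θ'⟩

/-- The map `χ(σ)_g : Nat(id, α_g) → Nat(id, β_g)` of a morphism `σ : α → β`, computed with a right
adjoint `R` of `σ`. Its value at `θ` is the composite
`id ⇒ σ R ⇒ σ α_g R ⇒ β_g σ R ⇒ β_g`, whose first map is the unit of the adjunction `Ψ(R ⊢ σ)` which
makes `R` a left adjoint of `σ`, and whose last map is the counit of the given adjunction. -/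
noncomputable def chiApp {α β : TwoRep.{v, u} G} (σ : α ⟶ β)
    (R : RightAdjoint (TwoRep.Hom.toStar σ)) (g : G) :
    (twoTrace (α.act g)).carrier →ₗ[ℂ] (twoTrace (β.act g)).carrier where
  toFun := fun (θ : 𝟭 α.space ⟶ α.fn g) =>
    { app := fun y => (Psi R.adj).unit.app y ≫
        (TwoRep.Hom.fn σ).map (θ.app (R.functor.functor.obj y)) ≫
        (TwoRep.Hom.nat σ g).inv.app (R.functor.functor.obj y) ≫
        (β.fn g).map (R.adj.counit.app y)
      naturality := by
        intro y y' f
        have h1 := (Psi R.adj).unit.naturality f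
        have h2 := congrArg (TwoRep.Hom.fn σ).map (θ.naturality (R.functor.functor.map f))
        have h3 := (TwoRep.Hom.nat σ g).inv.naturality (R.functor.functor.map f)
        have h4 := congrArg (β.fn g).map (R.adj.counit.naturality f)
        simp only [Functor.comp_map, Functor.id_map, Functor.map_comp] at h1 h2 h3 h4
        simp only [Functor.id_map, Category.assoc, ← h4, ← reassoc_of% h3, ← reassoc_of% h2,
          ← reassoc_of% h1] }
  map_add' := fun (θ θ' : 𝟭 α.space ⟶ α.fn g) => by
    refine NatTrans.ext (funext fun y => ?_)
    change _ = _ ≫ _ + _ ≫ _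
    simp only [← Preadditive.comp_add, ← Preadditive.add_comp, ← Functor.map_add]
    rfl
  map_smul' := fun c (θ : 𝟭 α.space ⟶ α.fn g) => by
    refine NatTrans.ext (funext fun y => ?_)
    change _ = c • (_ ≫ _)
    rw [← Linear.comp_smul, ← Linear.smul_comp, ← Functor.map_smul]
    rfl

end Character

end TwoHilbert

open TwoHilbert

/-! The linear form `f ↦ (1, f)` on endomorphisms is a cyclic trace, and the pairing `(f, g) ↦ (1, f
≫ g)` of `Hom(x, y)` with `Hom(y, x)` is nondegenerate. In these terms the unit `u` of the
even-handed adjunction at `y` is the only map with `tr(u ≫ F k ≫ ε) = tr k` for all endomorphisms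
`k` of `F* y`, because every map `F (F* y) ⟶ y` has the form `F k ≫ ε`. The data entering the
component of `χ(σ)_g θ` at `y` is therefore a triple (object, counit, unit) described by a universal
property and a trace condition at the single object `y`, recorded as `PointAdjoint`. Such triples
are unique up to an isomorphism compatible with counit and unit (`PointAdjoint.exists_iso`), and the
formula for `χ` does not change along such an isomorphism (`chiAt_eq`). So each component may be
computed with any convenient triple, chosen separately for each `y`.

Each assertion about `χ` then amounts to a choice of triple: `(y, 1, 1)` for the identity, the
composite triple for `τσ`, the transported triple for `σ ≅ ρ`, and for equivariance the image `α_h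
A` as a triple at `β_h y`. The last choice works because `α_h` and `β_h` are bijective on hom-spaces
and preserve traces. It suffices to treat objects `β_h y`, since the values there determine a
conjugate (`eq_conjNat`).

For the existence of right adjoints, `Hom(F -, y)` is represented by a direct sum of simple objects
(`exists_universal`). The representing pair is then rescaled by the inverse square root of a
positive endomorphism, so that the representation is isometric on hom-spaces
(`exists_unitary_universal`). Isometry is what makes the adjoint functor preserve `*`
(`nonempty_rightAdjoint`). -/

namespace TwoHilbert

/-! ### The trace `f ↦ (1, f)` on endomorphisms. -/

section Trace

variable {H : Type u} [Category.{v} H] [Preadditive H] [Linear ℂ H] [HStarCategory H]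

lemma ip_id_comp {x y : H} (f : x ⟶ y) (g : y ⟶ x) : ip (𝟙 x) (f ≫ g) = ip (dag f) g := by
  have h := ip_comp_right (dag f) (𝟙 x) g
  rw [Category.comp_id, dag, dag, HStarCategory.dag_dag] at h
  exact h.symm

/-- The trace `f ↦ (1, f)` is cyclic. -/
lemma ip_id_comp_comm {x y : H} (f : x ⟶ y) (g : y ⟶ x) :
    ip (𝟙 x) (f ≫ g) = ip (𝟙 y) (g ≫ f) := by
  have h := ip_comp_left (𝟙 y) (dag f) g
  rw [Category.id_comp, dag, dag, HStarCategory.dag_dag] at h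
  rw [ip_id_comp, ← h]

end Trace

/-- Nondegeneracy of the trace pairing: it is the inner product with `*` applied to one argument. -/
lemma eq_of_ip_id_comp {K : TwoHilb.{v, u}} {x y : K} {f f' : x ⟶ y}
    (h : ∀ g : y ⟶ x, ip (𝟙 x) (f ≫ g) = ip (𝟙 x) (f' ≫ g)) : f = f' := by
  have h' : dag f = dag f' := ip_ext fun g => by rw [← ip_id_comp, ← ip_id_comp, h]
  simpa only [dag, HStarCategory.dag_dag] using congrArg dag h'

/-- The value at `y` of a right adjoint of `F`, together with the components at `y` of its counit
and of the unit of the even-handed adjunction, which is characterized by a trace condition. -/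
structure PointAdjoint {H K : TwoHilb.{v, u}} (F : StarFunctor H K) (y : K) where
  obj : H
  counit : F.functor.obj obj ⟶ y
  unit : y ⟶ F.functor.obj obj
  exists_lift {x : H} (f : F.functor.obj x ⟶ y) : ∃ k : x ⟶ obj, F.functor.map k ≫ counit = f
  lift_unique {x : H} {k k' : x ⟶ obj} :
    F.functor.map k ≫ counit = F.functor.map k' ≫ counit → k = k'
  trace (k : obj ⟶ obj) : ip (𝟙 y) (unit ≫ F.functor.map k ≫ counit) = ip (𝟙 obj) k

/-! ### Uniqueness and constructions of pointwise right adjoints. -/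

namespace PointAdjoint

variable {H K L : TwoHilb.{v, u}}

/-- The universal property yields the isomorphism and its compatibility with the counits. For the
units one tests against `F k ≫ B.counit`, which exhausts the maps to `y`; cyclicity gives `tr(d ≫ k
≫ d') = tr k`, so both units satisfy the same trace condition. -/
lemma exists_iso {F : StarFunctor H K} {y : K} (A B : PointAdjoint F y) :
    ∃ δ : A.obj ≅ B.obj, F.functor.map δ.hom ≫ B.counit = A.counit ∧
      A.unit ≫ F.functor.map δ.hom = B.unit := by
  obtain ⟨d, hd⟩ := B.exists_lift A.counit
  obtain ⟨d', hd'⟩ := A.exists_lift B.counit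
  refine ⟨⟨d, d', A.lift_unique (by simp [hd, hd']), B.lift_unique (by simp [hd, hd'])⟩, hd, ?_⟩
  have hdd : d' ≫ d = 𝟙 _ := B.lift_unique (by simp [hd, hd'])
  refine eq_of_ip_id_comp fun g => ?_
  obtain ⟨k, rfl⟩ := B.exists_lift g
  have h := A.trace (d ≫ k ≫ d')
  rw [ip_id_comp_comm d, Category.assoc, hdd, Category.comp_id] at h
  simpa [hd', ← B.trace k] using h

/-- The pointwise right adjoint given by a right adjoint. -/
noncomputable def ofRightAdjoint {F : StarFunctor H K} (R : RightAdjoint F) (y : K) :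
    PointAdjoint F y where
  obj := R.functor.functor.obj y
  counit := R.adj.counit.app y
  unit := (Psi R.adj).unit.app y
  exists_lift {x} f := ⟨R.adj.homEquiv x y f, by
    rw [← Adjunction.homEquiv_counit, Equiv.symm_apply_apply]⟩
  lift_unique {x k k'} h := by
    rw [← Adjunction.homEquiv_counit, ← Adjunction.homEquiv_counit] at h
    exact (R.adj.homEquiv x y).symm.injective h
  trace k := by
    -- The unit is `Ψ(φ)(1) = (φ*(1))*`, so pairing it with `f` gives `(1, φ f)`, and `φ` sends `F k
    -- ≫ ε` to `k`.
    have hu : (Psi R.adj).unit.app y = evenHandedHom R.adj _ y (𝟙 _) := by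
      simp [Psi, evenHandedEquiv]
    rw [ip_id_comp, hu, ip_evenHandedHom, dag_id, ← Adjunction.homEquiv_counit,
      Equiv.apply_symm_apply]

/-- The pointwise right adjoint of the identity. -/
def id (y : H) : PointAdjoint (StarFunctor.id H) y where
  obj := y
  counit := 𝟙 y
  unit := 𝟙 y
  exists_lift f := ⟨f, Category.comp_id f⟩
  lift_unique {_ k k'} h := (Category.comp_id k).symm.trans (h.trans (Category.comp_id k'))
  trace k := by simp

/-- The pointwise right adjoint of a composite. -/
def comp {F : StarFunctor H K} {F' : StarFunctor K L} {y : L} (B : PointAdjoint F' y)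
    (A : PointAdjoint F B.obj) : PointAdjoint (F.comp F') y where
  obj := A.obj
  counit := F'.functor.map A.counit ≫ B.counit
  unit := B.unit ≫ F'.functor.map A.unit
  exists_lift f := by
    obtain ⟨k, rfl⟩ := B.exists_lift f
    obtain ⟨l, rfl⟩ := A.exists_lift k
    exact ⟨l, by simp⟩
  lift_unique {x k k'} h := by
    refine A.lift_unique (B.lift_unique ?_)
    simpa using h
  trace k := by
    -- The two trace conditions are applied in succession, the outer one to an endomorphism of
    -- `B.obj`.
    have h := B.trace (A.unit ≫ F.functor.map k ≫ A.counit)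
    rw [A.trace] at h
    simpa using h

/-- Transport of a pointwise right adjoint along a natural isomorphism. -/
def ofIso {F F' : StarFunctor H K} (e : F.functor ≅ F'.functor) {y : K} (A : PointAdjoint F y) :
    PointAdjoint F' y where
  obj := A.obj
  counit := e.inv.app A.obj ≫ A.counit
  unit := A.unit ≫ e.hom.app A.obj
  exists_lift {x} f := by
    obtain ⟨k, hk⟩ := A.exists_lift (e.hom.app x ≫ f)
    exact ⟨k, by simp [hk]⟩
  lift_unique {x k k'} h := by
    refine A.lift_unique ?_
    simpa using h
  trace k := by simp [A.trace]

end PointAdjoint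

/-! ### The maps `χ(σ)_g` computed with pointwise right adjoints. -/

section Character

variable {G : Type w} [Group G] {α β γ : TwoRep.{v, u} G}

/-- The component of `χ(σ)_g θ` at `y`, computed with a pointwise right adjoint. -/
def chiAt (σ : TwoRep.Hom α β) {y : β.space} (A : PointAdjoint σ.toStar y) {g : G}
    (θ : 𝟭 α.space ⟶ α.fn g) : y ⟶ (β.fn g).obj y :=
  A.unit ≫ σ.fn.map (θ.app A.obj) ≫ (σ.nat g).inv.app A.obj ≫ (β.fn g).map A.counit

/-- The comparison isomorphism `δ` enters at the unit of `B` and is moved by naturality of `θ` and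
of `σ(g)⁻¹` to the counit, where it is absorbed. -/
lemma chiAt_eq (σ : TwoRep.Hom α β) {y : β.space} (A B : PointAdjoint σ.toStar y) {g : G}
    (θ : 𝟭 α.space ⟶ α.fn g) : chiAt σ A θ = chiAt σ B θ := by
  obtain ⟨δ, h₁, h₂⟩ := A.exists_iso B
  have n₁ := congrArg σ.fn.map (θ.naturality δ.hom)
  have n₂ := (σ.nat g).inv.naturality δ.hom
  simp only [Functor.comp_map, Functor.id_map, Functor.map_comp] at n₁ n₂
  rw [chiAt, chiAt, ← h₁, ← h₂, Functor.map_comp, ← reassoc_of% n₂, Category.assoc,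
    reassoc_of% n₁]

/-- The isomorphism attached to the unit cancels its inverse attached to the counit; the
modification condition lets it pass `ρ(g)⁻¹`. -/
lemma chiAt_ofIso {σ ρ : TwoRep.Hom α β} (e : σ ≅ ρ) {y : β.space}
    (A : PointAdjoint σ.toStar y) {g : G} (θ : 𝟭 α.space ⟶ α.fn g)
    (e' : σ.fn ≅ ρ.fn) (he : e'.hom = TwoRep.Hom₂.toNat e.hom) :
    chiAt ρ (A.ofIso (F' := ρ.toStar) e') θ = chiAt σ A θ := by
  have c := TwoRep.Hom₂.comm e.hom g A.obj
  rw [← he] at c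
  have n := e'.hom.naturality (θ.app A.obj)
  have c' : e'.hom.app ((α.fn g).obj A.obj) ≫ (ρ.nat g).inv.app A.obj ≫
      (β.fn g).map (e'.inv.app A.obj) = (σ.nat g).inv.app A.obj := by
    rw [← cancel_epi ((σ.nat g).hom.app A.obj), reassoc_of% c, Iso.hom_inv_id_app_assoc,
      Iso.hom_inv_id_app, ← Functor.map_comp, Iso.hom_inv_id_app, CategoryTheory.Functor.map_id]
    rfl
  simp only [Functor.id_obj] at n
  simp only [chiAt, PointAdjoint.ofIso, Functor.map_comp, Category.assoc]
  rw [← reassoc_of% n, reassoc_of% c']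

lemma chiAt_id {y : α.space} {g : G} (θ : 𝟭 α.space ⟶ α.fn g) :
    chiAt (TwoRep.Hom.id α) (PointAdjoint.id y) θ = θ.app y := by
  have h' : chiAt (TwoRep.Hom.id α) (PointAdjoint.id y) θ =
      𝟙 y ≫ θ.app y ≫ 𝟙 _ ≫ (α.fn g).map (𝟙 y) := rfl
  rw [h']
  simp

/-- The composite triple inserts `χ(σ)_g θ` between the unit and the counit of `B`, once `τ(g)⁻¹`
has been moved past the counit of `A` by naturality. -/
lemma chiAt_comp (σ : TwoRep.Hom α β) (τ : TwoRep.Hom β γ) {y : γ.space}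
    (B : PointAdjoint τ.toStar y) (A : PointAdjoint σ.toStar B.obj) {g : G}
    (θ : 𝟭 α.space ⟶ α.fn g) (θ' : 𝟭 β.space ⟶ β.fn g) (hθ : θ'.app B.obj = chiAt σ A θ) :
    chiAt (σ.comp τ) (B.comp A) θ = chiAt τ B θ' := by
  have n := (τ.nat g).inv.naturality A.counit
  have h : ((σ.comp τ).nat g).inv.app A.obj =
    τ.fn.map ((σ.nat g).inv.app A.obj) ≫ (τ.nat g).inv.app (σ.fn.obj A.obj) := rfl
  simp only [Functor.comp_map] at n
  have lhs : chiAt (σ.comp τ) (B.comp A) θ = (B.unit ≫ τ.fn.map A.unit) ≫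
      τ.fn.map (σ.fn.map (θ.app A.obj)) ≫
        (τ.fn.map ((σ.nat g).inv.app A.obj) ≫ (τ.nat g).inv.app (σ.fn.obj A.obj)) ≫
          (γ.fn g).map (τ.fn.map A.counit ≫ B.counit) := rfl
  rw [lhs, chiAt, hθ, chiAt]
  simp only [Functor.map_comp, Category.assoc]
  rw [reassoc_of% n]

lemma exists_map_eq (α : TwoRep.{v, u} G) (h : G) {x y : α.space}
    (f : (α.fn h).obj x ⟶ (α.fn h).obj y) : ∃ k : x ⟶ y, (α.fn h).map k = f :=
  (α.act_unitary h x y).2 f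

lemma ip_id_map (α : TwoRep.{v, u} G) (h : G) {x : α.space} (f : x ⟶ x) :
    ip (𝟙 ((α.fn h).obj x)) ((α.fn h).map f) = ip (𝟙 x) f := by
  have := (α.act_unitary h x x).1 (𝟙 x) f
  rwa [CategoryTheory.Functor.map_id] at this

/-- Every object lies, up to isomorphism, in the image of `α_h`. -/
def actIso (α : TwoRep.{v, u} G) (h : G) (x : α.space) :
    x ≅ (α.fn h).obj ((α.fn h⁻¹).obj x) :=
  α.unit.app x ≪≫ ((α.mult h h⁻¹ 1 (mul_inv_cancel h)).app x).symm

/-- With `ε` the counit of a triple `A`, this reduces the universal property and the trace condition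
of `A.act h` to those of `A`. -/
lemma map_act_comp (σ : TwoRep.Hom α β) (h : G) {x z : α.space} {y : β.space} (k : x ⟶ z)
    (ε : σ.fn.obj z ⟶ y) :
    σ.fn.map ((α.fn h).map k) ≫ (σ.nat h).inv.app z ≫ (β.fn h).map ε =
      (σ.nat h).inv.app x ≫ (β.fn h).map (σ.fn.map k ≫ ε) := by
  have n := (σ.nat h).inv.naturality k
  simp only [Functor.comp_map] at n
  rw [reassoc_of% n, ← Functor.map_comp]

/-- Transport of a pointwise right adjoint of a morphism `σ : α → β` at `y` to `β_h y`. -/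
def PointAdjoint.act {σ : TwoRep.Hom α β} {y : β.space} (A : PointAdjoint σ.toStar y) (h : G) :
    PointAdjoint σ.toStar ((β.fn h).obj y) where
  obj := (α.fn h).obj A.obj
  counit := (σ.nat h).inv.app A.obj ≫ (β.fn h).map A.counit
  unit := (β.fn h).map A.unit ≫ (σ.nat h).hom.app A.obj
  exists_lift {x} f := by
    -- After replacing `x` by `α_h (α_{h⁻¹} x)` and commuting `σ` with the action, the given map has
    -- the form `β_h f'`, and `f'` lifts through `A`.
    obtain ⟨f', hf'⟩ := exists_map_eq β h ((σ.nat h).hom.app ((α.fn h⁻¹).obj x) ≫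
      σ.fn.map (actIso α h x).inv ≫ f)
    obtain ⟨k, hk⟩ := A.exists_lift f'
    refine ⟨(actIso α h x).hom ≫ (α.fn h).map k, ?_⟩
    rw [Functor.map_comp, Category.assoc, map_act_comp, hk, hf', Iso.inv_hom_id_app_assoc,
      ← Functor.map_comp_assoc, Iso.hom_inv_id, CategoryTheory.Functor.map_id, Category.id_comp]
  lift_unique {x k k'} H := by
    obtain ⟨l, hl⟩ := exists_map_eq α h ((actIso α h x).inv ≫ k)
    obtain ⟨l', hl'⟩ := exists_map_eq α h ((actIso α h x).inv ≫ k')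
    rw [← cancel_epi (actIso α h x).inv, ← hl, ← hl']
    congr 1
    refine A.lift_unique (map_injective β h ?_)
    rw [← cancel_epi ((σ.nat h).inv.app _), ← map_act_comp, ← map_act_comp, hl, hl',
      Functor.map_comp, Functor.map_comp, Category.assoc, Category.assoc, H]
  trace k := by
    obtain ⟨l, rfl⟩ := exists_map_eq α h k
    rw [map_act_comp, Category.assoc, Iso.hom_inv_id_app_assoc, ← Functor.map_comp, ip_id_map,
      A.trace, ip_id_map]

/-- This is the equation characterizing `conjNat` in `eq_conjNat`, for the family of components of
`χ(σ)`. It follows from the corresponding equation for `θ`, namely `conjNat_spec`, transported by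
`σ` with the coherence of the isomorphisms `σ(g)`. -/
lemma chiAt_act_comp (σ : TwoRep.Hom α β) {y : β.space} (A : PointAdjoint σ.toStar y) {g g' : G}
    (h : G) (e : h * g * h⁻¹ = g') (θ : 𝟭 α.space ⟶ α.fn g) (k : G) (hk : h * g = k)
    (hk' : g' * h = k) :
    chiAt σ (A.act h) (conjNat α h e θ) ≫ (β.mult g' h k hk').hom.app y =
      (β.fn h).map (chiAt σ A θ) ≫ (β.mult h g k hk).hom.app y := by
  -- The multiplicativity axiom `nat_mult` solved for the inverses, which are what occurs in
  -- `chiAt`.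
  have inv_mult (g₂ g₁ g : G) (e : g₂ * g₁ = g) (x : α.space) :
      (σ.nat g₂).inv.app ((α.fn g₁).obj x) ≫ (β.fn g₂).map ((σ.nat g₁).inv.app x) ≫
        (β.mult g₂ g₁ g e).hom.app (σ.fn.obj x) =
      σ.fn.map ((α.mult g₂ g₁ g e).hom.app x) ≫ (σ.nat g).inv.app x := by
    have m := σ.nat_mult g₂ g₁ g e x
    rw [← cancel_mono ((σ.nat g).hom.app x)]
    simp only [Category.assoc]
    have i : (β.fn g₂).map ((σ.nat g₁).inv.app x) ≫ (β.fn g₂).map ((σ.nat g₁).hom.app x) =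
        𝟙 _ := by
      rw [← Functor.map_comp, Iso.inv_hom_id_app]
      exact CategoryTheory.Functor.map_id _ _
    rw [m, reassoc_of% i, Iso.inv_hom_id_app_assoc, Iso.inv_hom_id_app]
    exact (Category.comp_id _).symm
  have n₁ := (β.mult g' h k hk').hom.naturality A.counit
  have n₂ := (β.mult h g k hk).hom.naturality A.counit
  have n₃ := (σ.nat h).hom.naturality (θ.app A.obj)
  have s := congrArg σ.fn.map (conjNat_spec α h e θ k hk hk' A.obj)
  simp only [Functor.comp_map, Functor.map_comp, Functor.id_obj] at n₁ n₂ n₃ s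
  simp only [chiAt, PointAdjoint.act, Functor.map_comp, Category.assoc]
  rw [n₁, n₂, reassoc_of% (inv_mult g' h k hk' A.obj), reassoc_of% s, ← reassoc_of% n₃,
    ← reassoc_of% (inv_mult h g k hk A.obj), Iso.hom_inv_id_app_assoc]

/-- By definition `chiApp` is `chiAt` for the triple `ofRightAdjoint R y`; any other triple may
replace it. -/
lemma chiApp_app {α β : TwoRep.{v, u} G} (σ : α ⟶ β) (R : RightAdjoint (TwoRep.Hom.toStar σ))
    (g : G) (θ : 𝟭 α.space ⟶ α.fn g) (y : β.space) (A : PointAdjoint (TwoRep.Hom.toStar σ) y) :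
    NatTrans.app (F := 𝟭 β.space) (G := β.fn g) (chiApp σ R g θ) y = chiAt σ A θ :=
  chiAt_eq σ (PointAdjoint.ofRightAdjoint R y) A θ

lemma chiApp_ext {α β : TwoRep.{v, u} G} {g : G}
    {T T' : (twoTrace (α.act g)).carrier →ₗ[ℂ] (twoTrace (β.act g)).carrier}
    (h : ∀ (θ : 𝟭 α.space ⟶ α.fn g) (y : β.space),
      NatTrans.app (F := 𝟭 β.space) (G := β.fn g) (T θ) y =
        NatTrans.app (F := 𝟭 β.space) (G := β.fn g) (T' θ) y) : T = T' :=
  LinearMap.ext fun θ => NatTrans.ext (funext (h θ))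

/-- For `e` the identity this is the independence of the right adjoint. -/
lemma chiApp_eq_of_iso {α β : TwoRep.{v, u} G} {σ ρ : α ⟶ β} (e : σ ≅ ρ)
    (R : RightAdjoint (TwoRep.Hom.toStar σ)) (R' : RightAdjoint (TwoRep.Hom.toStar ρ)) (g : G) :
    chiApp σ R g = chiApp ρ R' g := by
  refine chiApp_ext fun θ y => ?_
  let e' : TwoRep.Hom.fn σ ≅ TwoRep.Hom.fn ρ :=
    ⟨TwoRep.Hom₂.toNat e.hom, TwoRep.Hom₂.toNat e.inv,
      congrArg TwoRep.Hom₂.toNat e.hom_inv_id, congrArg TwoRep.Hom₂.toNat e.inv_hom_id⟩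
  let A := PointAdjoint.ofRightAdjoint R y
  rw [chiApp_app σ R g θ y A, chiApp_app ρ R' g θ y (A.ofIso e')]
  exact (chiAt_ofIso e A θ e' rfl).symm

lemma conjLin_chiApp {α β : TwoRep.{v, u} G} (σ : α ⟶ β)
    (R : RightAdjoint (TwoRep.Hom.toStar σ)) {g g' : G} (h : G) (e : h * g * h⁻¹ = g')
    (θ : 𝟭 α.space ⟶ α.fn g) :
    chiApp σ R g' (conjNat α h e θ) = conjNat β h e (chiApp σ R g θ) := by
  have k : g' * h = h * g := by rw [← e]; group
  refine eq_conjNat β h e _ (h * g) rfl k _ fun y => ?_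
  have A := PointAdjoint.ofRightAdjoint R y
  rw [chiApp_app σ R g θ y A, chiApp_app σ R g' _ _ (A.act h)]
  exact chiAt_act_comp σ A h e θ _ rfl k

lemma chiApp_id (α : TwoRep.{v, u} G) (R : RightAdjoint (TwoRep.Hom.toStar (𝟙 α))) (g : G) :
    chiApp (𝟙 α) R g = LinearMap.id :=
  chiApp_ext fun θ y => (chiApp_app (𝟙 α) R g θ y (PointAdjoint.id y)).trans (chiAt_id θ)

lemma chiApp_comp {α β γ : TwoRep.{v, u} G} (σ : α ⟶ β) (τ : β ⟶ γ)
    (R : RightAdjoint (TwoRep.Hom.toStar σ)) (S : RightAdjoint (TwoRep.Hom.toStar τ))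
    (T : RightAdjoint (TwoRep.Hom.toStar (σ ≫ τ))) (g : G) :
    chiApp (σ ≫ τ) T g = chiApp τ S g ∘ₗ chiApp σ R g := by
  refine chiApp_ext fun θ y => ?_
  let B := PointAdjoint.ofRightAdjoint S y
  let A := PointAdjoint.ofRightAdjoint R B.obj
  refine (chiApp_app (σ ≫ τ) T g θ y (B.comp A)).trans ?_
  refine Eq.trans ?_ (chiApp_app τ S g (chiApp σ R g θ) y B).symm
  exact chiAt_comp σ τ B A θ _ (chiApp_app σ R g θ _ A)

end Character

/-! ### Square roots of positive endomorphisms. -/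

/-- A positive operator on a finite-dimensional Hilbert space has a symmetric square root, which
commutes with every operator that commutes with it. -/
lemma exists_symmetric_sqrt {E : Type*} [NormedAddCommGroup E] [InnerProductSpace ℂ E]
    [FiniteDimensional ℂ E] {T : E →ₗ[ℂ] E} (hT : T.IsPositive) :
    ∃ S : E →ₗ[ℂ] E, S.IsSymmetric ∧ S ∘ₗ S = T ∧
      ∀ U : E →ₗ[ℂ] E, T ∘ₗ U = U ∘ₗ T → S ∘ₗ U = U ∘ₗ S := by
  have : CompleteSpace E := FiniteDimensional.complete ℂ E
  let T' : E →L[ℂ] E := LinearMap.toContinuousLinearMap T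
  have hT' : 0 ≤ T' := by
    rw [ContinuousLinearMap.nonneg_iff_isPositive]
    exact (LinearMap.isPositive_toContinuousLinearMap_iff T).mpr hT
  have hS : (CFC.sqrt T').IsPositive := by
    rw [← ContinuousLinearMap.nonneg_iff_isPositive]
    exact CFC.sqrt_nonneg T'
  refine ⟨(CFC.sqrt T' : E →L[ℂ] E).toLinearMap, hS.isSymmetric, ?_, fun U hU => ?_⟩
  · have h := CFC.sqrt_mul_sqrt_self T' hT'
    exact LinearMap.ext fun v => congrArg (fun f : E →L[ℂ] E => f v) h
  · have hc : Commute T' (LinearMap.toContinuousLinearMap U) :=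
      ContinuousLinearMap.ext fun v => LinearMap.congr_fun hU v
    have h : Commute (CFC.sqrt T') (LinearMap.toContinuousLinearMap U) := by
      rw [CFC.sqrt]
      exact hc.cfcₙ_nnreal _
    exact LinearMap.ext fun v => congrArg (fun f : E →L[ℂ] E => f v) h.eq

/-- A positive endomorphism has a self-adjoint square root. -/
lemma exists_dag_eq_sqrt {H : TwoHilb.{v, u}} {z : H} {a : z ⟶ z} (ha : dag a = a)
    (hpos : ∀ k : z ⟶ z, 0 ≤ (ip (k ≫ a) k).re) : ∃ s : z ⟶ z, dag s = s ∧ s ≫ s = a := by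
  let := homNormed z z
  let := homInner z z
  have : FiniteDimensional ℂ (z ⟶ z) := HStarCategory.finite_hom z z
  have hT : (Linear.rightComp ℂ z a : (z ⟶ z) →ₗ[ℂ] (z ⟶ z)).IsPositive := by
    refine ⟨fun k l => ?_, fun k => hpos k⟩
    have h := ip_comp_left k a l
    rwa [ha] at h
  obtain ⟨S, hS, hSS, hU⟩ := exists_symmetric_sqrt hT
  -- The square root of right multiplication by `a` commutes with left multiplications, so it is
  -- itself right multiplication by its value at `1`.
  have hs (k : z ⟶ z) : k ≫ S (𝟙 z) = S k := by
    have h := LinearMap.congr_fun (hU (Linear.leftComp ℂ z k)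
      (LinearMap.ext fun l => Category.assoc k l a)) (𝟙 z)
    simpa using h.symm
  refine ⟨S (𝟙 z), ip_ext fun f => ?_, ?_⟩
  -- Symmetry of the operator `S` becomes `s* = s` through cyclicity of the trace.
  · rw [← ip_id_comp, ip_id_comp_comm, hs]
    exact (hS (𝟙 z) f).symm
  · rw [hs]
    exact (LinearMap.congr_fun hSS (𝟙 z)).trans (Category.id_comp a)

/-! ### Invertibility of injective endomorphisms, and Schur's lemma. -/

section HStar

variable {H : Type u} [Category.{v} H] [Preadditive H] [Linear ℂ H]

/-- An injective endomorphism is invertible. -/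
lemma exists_inverse [HStarCategory H] {z : H} {s : z ⟶ z}
    (hs : ∀ k : z ⟶ z, k ≫ s = 0 → k = 0) : ∃ t : z ⟶ z, t ≫ s = 𝟙 z ∧ s ≫ t = 𝟙 z := by
  have : FiniteDimensional ℂ (z ⟶ z) := HStarCategory.finite_hom z z
  have hinj : Function.Injective (Linear.rightComp ℂ z s : (z ⟶ z) →ₗ[ℂ] (z ⟶ z)) :=
    (injective_iff_map_eq_zero _).mpr hs
  obtain ⟨t, ht⟩ := LinearMap.injective_iff_surjective.mp hinj (𝟙 z)
  replace ht : t ≫ s = 𝟙 z := ht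
  refine ⟨t, ht, sub_eq_zero.mp (hs _ ?_)⟩
  rw [Preadditive.sub_comp, Category.assoc, ht, Category.comp_id, Category.id_comp, sub_self]

variable [TwoHilbertSpace H]

/-- Schur's lemma. -/
lemma IsSimple.nonempty_iso {x y : H} (hx : IsSimple x) (hy : IsSimple y) {f : x ⟶ y}
    (hf : f ≠ 0) : Nonempty (x ≅ y) := by
  obtain ⟨c, hc⟩ := hx.exists_smul (f ≫ dag f)
  obtain ⟨d, hd⟩ := hy.exists_smul (dag f ≫ f)
  have hc0 : c ≠ 0 := by
    rintro rfl
    refine hf (ip_definite f ?_)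
    have h := ip_comp_left (𝟙 x) f f
    rw [Category.id_comp, ← hc, ip_smul_right, zero_mul] at h
    exact h
  -- Both scalars describe `f ≫ f* ≫ f`; hence `c⁻¹ f*` is a two-sided inverse of `f`.
  have hdc : d = c := by
    have h : c • f = d • f := by
      rw [← Category.id_comp f, ← Linear.smul_comp, hc, Category.id_comp, Category.assoc, ← hd,
        Linear.comp_smul, Category.comp_id]
    exact (smul_left_injective ℂ hf h).symm
  refine ⟨⟨f, c⁻¹ • dag f, ?_, ?_⟩⟩
  · rw [Linear.comp_smul, ← hc, smul_smul, inv_mul_cancel₀ hc0, one_smul]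
  · rw [Linear.smul_comp, ← hd, hdc, smul_smul, inv_mul_cancel₀ hc0, one_smul]

lemma SimpleClass.hom_eq_zero {c c' : SimpleClass H} (h : c ≠ c') (f : c.rep ⟶ c'.rep) :
    f = 0 := by
  by_contra hf
  refine h ?_
  rw [← c.mk_rep, ← c'.mk_rep]
  exact (SimpleClass.mk_eq_iff _ _).mpr (c.isSimple_rep.nonempty_iso c'.isSimple_rep hf)

end HStar

/-! ### Existence of right adjoints in 2-Hilbert spaces. -/

variable {H K : TwoHilb.{v, u}}

/-- The presheaf `Hom(F -, y)` is representable. -/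
lemma exists_universal (F : StarFunctor H K) (y : K) :
    ∃ (z : H) (p : F.functor.obj z ⟶ y), ∀ (x : H) (f : F.functor.obj x ⟶ y),
      ∃! k : x ⟶ z, F.functor.map k ≫ p = f := by
  classical
  have : HasFiniteBiproducts H := TwoHilbertSpace.hasFiniteBiproducts
  have (c : SimpleClass H) : Module.Finite ℂ (F.functor.obj c.rep ⟶ y) :=
    HStarCategory.finite_hom _ _
  let b (c : SimpleClass H) := Module.finBasis ℂ (F.functor.obj c.rep ⟶ y)
  -- The representing object is `⨁_c Hom(F e_c, y) ⊗ e_c`: one copy of `e_c` for each basis vector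
  -- of `Hom(F e_c, y)`. The map `p` restricts to that basis vector on each copy.
  let J := Σ c : SimpleClass H, Fin (Module.finrank ℂ (F.functor.obj c.rep ⟶ y))
  have : HasBiproductsOfShape J H.carrier := hasBiproductsOfShape_finite H.carrier
  let e : J → H := fun j => j.1.rep
  let p : F.functor.obj (⨁ e) ⟶ y := ∑ j : J, F.functor.map (biproduct.π e j) ≫ b j.1 j.2
  have hp (j : J) : F.functor.map (biproduct.ι e j) ≫ p = b j.1 j.2 := by
    simp only [p, Preadditive.comp_sum, ← Functor.map_comp_assoc]
    rw [Finset.sum_eq_single j]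
    · simp
    · intro j' _ hj
      rw [biproduct.ι_π_ne e hj.symm]
      simp
    · simp
  refine ⟨⨁ e, p, fun x => ?_⟩
  induction x using simple_induction with
  | hzero x hx =>
    have h0 (w : H) (g : x ⟶ w) : g = 0 := by rw [← Category.id_comp g, hx, zero_comp]
    intro f
    refine ⟨0, ?_, fun k _ => h0 _ k⟩
    change F.functor.map 0 ≫ p = f
    rw [← Category.id_comp f, ← F.functor.map_id, hx, Functor.map_zero, zero_comp,
      Functor.map_zero, zero_comp]
  | hsum x x₁ x₂ i r j s hrs h₁ h₂ =>
    intro f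
    obtain ⟨k₁, hk₁, hu₁⟩ := h₁ (F.functor.map i ≫ f)
    obtain ⟨k₂, hk₂, hu₂⟩ := h₂ (F.functor.map j ≫ f)
    refine ⟨r ≫ k₁ + s ≫ k₂, ?_, fun k hk => ?_⟩
    · change F.functor.map (r ≫ k₁ + s ≫ k₂) ≫ p = f
      rw [Functor.map_add, Preadditive.add_comp, Functor.map_comp, Functor.map_comp,
        Category.assoc, Category.assoc, hk₁, hk₂, ← Functor.map_comp_assoc,
        ← Functor.map_comp_assoc, ← Preadditive.add_comp, ← Functor.map_add, hrs,
        CategoryTheory.Functor.map_id, Category.id_comp]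
    · rw [← hu₁ (i ≫ k) (by simp [hk]), ← hu₂ (j ≫ k) (by simp [hk]), ← Category.assoc,
        ← Category.assoc, ← Preadditive.add_comp, hrs, Category.id_comp]
  | hsimple x hx =>
    obtain ⟨i⟩ := SimpleClass.rep_iso x hx
    generalize SimpleClass.mk x hx = c at i
    intro f
    refine existsUnique_of_exists_of_unique ?_ ?_
    · refine ⟨i.inv ≫ ∑ l, (b c).repr (F.functor.map i.hom ≫ f) l • biproduct.ι e ⟨c, l⟩, ?_⟩
      rw [Functor.map_comp, Category.assoc, Functor.map_sum, Preadditive.sum_comp]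
      simp only [Functor.map_smul, Linear.smul_comp, hp]
      rw [(b c).sum_repr, ← Functor.map_comp_assoc]
      simp
    · intro k k' hk hk'
      rw [← sub_eq_zero]
      have h0 : F.functor.map (k - k') ≫ p = 0 := by
        rw [Functor.map_sub, Preadditive.sub_comp, hk, hk', sub_self]
      generalize k - k' = m at h0
      -- By Schur's lemma only the summands of class `c` contribute, each through a scalar. These
      -- scalars are the coefficients of a linear relation among basis vectors of `Hom(F e_c, y)`,
      -- so they vanish.
      have hexp : i.hom ≫ m = ∑ j : J, (i.hom ≫ m ≫ biproduct.π e j) ≫ biproduct.ι e j := by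
        simp only [Category.assoc, ← Preadditive.comp_sum]
        have ht : ∑ j : J, biproduct.π e j ≫ biproduct.ι e j = 𝟙 (⨁ e) :=
          IsBilimit.total (biproduct.isBilimit e)
        rw [ht, Category.comp_id]
      rw [Fintype.sum_sigma, Finset.sum_eq_single c] at hexp
      rotate_left
      · intro c' _ hc'
        refine Finset.sum_eq_zero fun l _ => ?_
        rw [SimpleClass.hom_eq_zero hc'.symm (i.hom ≫ m ≫ biproduct.π e ⟨c', l⟩), zero_comp]
      · simp
      have hc (l) := c.isSimple_rep.exists_smul (i.hom ≫ m ≫ biproduct.π e ⟨c, l⟩)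
      choose a ha using hc
      simp only [← ha, Linear.smul_comp, e, Category.id_comp] at hexp
      have hsum : ∑ l, a l • b c l = 0 := by
        have h1 : F.functor.map (i.hom ≫ m) ≫ p = 0 := by
          rw [Functor.map_comp, Category.assoc, h0, comp_zero]
        rw [hexp, Functor.map_sum, Preadditive.sum_comp] at h1
        rw [← h1]
        refine Finset.sum_congr rfl fun l _ => ?_
        rw [Functor.map_smul, Linear.smul_comp]
        exact congrArg (a l • ·) (hp ⟨c, l⟩).symm
      have ha0 := Fintype.linearIndependent_iff.mp (b c).linearIndependent a hsum
      rw [← cancel_epi i.hom, hexp, comp_zero]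
      simp [ha0]

/-- The presheaf of Hilbert spaces `Hom(F -, y)` is unitarily representable. -/
lemma exists_unitary_universal (F : StarFunctor H K) (y : K) :
    ∃ (z : H) (p : F.functor.obj z ⟶ y),
      (∀ (x : H) (f : F.functor.obj x ⟶ y), ∃! k : x ⟶ z, F.functor.map k ≫ p = f) ∧
      ∀ (x : H) (k l : x ⟶ z), ip (F.functor.map k ≫ p) (F.functor.map l ≫ p) = ip k l := by
  obtain ⟨z, p, hp⟩ := exists_universal F y
  let φ : (z ⟶ z) →ₗ[ℂ] (F.functor.obj z ⟶ y) :=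
    Linear.rightComp ℂ (F.functor.obj z) p ∘ₗ F.functor.mapLinearMap ℂ
  -- The endomorphism `a` measures the failure of `k ↦ F k ≫ p` to be isometric: `hform` shows that
  -- the pulled back inner product is `(k ≫ a, l)`. With `a = s ≫ s`, replacing `p` by `F s⁻¹ ≫ p`
  -- makes the map isometric.
  let a := homAdjoint φ p
  have ha (k : z ⟶ z) : ip a k = ip p (F.functor.map k ≫ p) := ip_homAdjoint φ p k
  have hform {x : H} (k l : x ⟶ z) :
      ip (F.functor.map k ≫ p) (F.functor.map l ≫ p) = ip (k ≫ a) l := by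
    rw [ip_comp_right, ip_comp_right, ha, Functor.map_comp, F.map_dag, Category.assoc]
  have hdag : dag a = a := by
    refine (ip_ext fun f => ?_).symm
    have h := ip_conj (F.functor.map (𝟙 z) ≫ p) (F.functor.map f ≫ p)
    rw [hform, hform, Category.id_comp, ip_conj] at h
    rw [← h, ip_id_comp_comm, ip_id_comp]
  obtain ⟨s, hs, hss⟩ := exists_dag_eq_sqrt hdag fun k => by
    rw [← hform]
    exact ip_self_nonneg _
  -- If `k ≫ s = 0`, then `F k ≫ p` has norm zero, and the universal property of `p` forces `k = 0`.
  obtain ⟨t, hts, hst⟩ := exists_inverse (s := s) fun k hk => by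
    have h : F.functor.map k ≫ p = 0 := by
      refine ip_definite _ ?_
      rw [hform, ← hss, reassoc_of% hk, zero_comp, ip_zero_left]
    obtain ⟨_, _, hu⟩ := hp z 0
    rw [hu k h, hu 0 (by simp)]
  refine ⟨z, F.functor.map t ≫ p, fun x f => ?_, fun x k l => ?_⟩
  · obtain ⟨k, hk, hu⟩ := hp x f
    refine ⟨k ≫ s, ?_, fun l hl => ?_⟩
    · change F.functor.map (k ≫ s) ≫ F.functor.map t ≫ p = f
      rw [← Functor.map_comp_assoc, Category.assoc, hst, Category.comp_id, hk]
    · rw [← hu (l ≫ t) (by simpa using hl), Category.assoc, hts, Category.comp_id]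
  · rw [← Functor.map_comp_assoc, ← Functor.map_comp_assoc, hform, ← hss, Category.assoc,
      reassoc_of% hts, ip_comp_left, hs, Category.assoc, hts, Category.comp_id]

/-- Universal maps `p y` at each object assemble into a right adjoint functor as usual, with
linearity following from uniqueness of lifts. Compatibility with `*` needs the isometry: it turns
`(R f*, g)` into `(p ≫ f*, F g ≫ p) = (p, F (g ≫ R f) ≫ p) = (1, g ≫ R f)`, which equals `((R f)*,
g)` by cyclicity. -/
lemma nonempty_rightAdjoint (F : StarFunctor H K) : Nonempty (RightAdjoint F) := by
  choose R p hp hip using exists_unitary_universal F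
  choose φ hφ hu using hp
  replace hφ (y : K) (x : H) (f : F.functor.obj x ⟶ y) : F.functor.map (φ y x f) ≫ p y = f :=
    hφ y x f
  replace hu (y : K) (x : H) {k k' : x ⟶ R y}
      (h : F.functor.map k ≫ p y = F.functor.map k' ≫ p y) : k = k' :=
    (hu y x _ k h).trans (hu y x _ k' rfl).symm
  let R' : K ⥤ H :=
    { obj := R
      map := fun {y y'} f => φ y' (R y) (p y ≫ f)
      map_id := fun y => hu _ _ (by simp [hφ])
      map_comp := fun f g => hu _ _ (by simp [hφ, reassoc_of% hφ]) }
  have hR {y y' : K} (f : y ⟶ y') : F.functor.map (R'.map f) ≫ p y' = p y ≫ f := hφ _ _ _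
  let adj : F.functor ⊣ R' := Adjunction.mkOfHomEquiv
    { homEquiv := fun x y =>
        { toFun := φ y x
          invFun := fun k => F.functor.map k ≫ p y
          left_inv := fun f => hφ y x f
          right_inv := fun k => hu y x (hφ y x _) }
      homEquiv_naturality_left_symm := fun f g => by simp
      homEquiv_naturality_right := fun {x y y'} f g => hu _ _ (by
        change F.functor.map (φ y' x (f ≫ g)) ≫ p y' =
          F.functor.map (φ y x f ≫ R'.map g) ≫ p y'
        rw [hφ, Functor.map_comp, Category.assoc, hR, reassoc_of% hφ]) }
  have hadd : R'.Additive := ⟨fun {y y' f g} => hu _ _ (by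
    rw [hR, Functor.map_add, Preadditive.add_comp, hR, hR, Preadditive.comp_add])⟩
  have hlin : R'.Linear ℂ := ⟨fun {y y'} f c => hu _ _ (by
    rw [hR, Functor.map_smul, Linear.smul_comp, hR, Linear.comp_smul])⟩
  refine ⟨⟨{ functor := R', map_dag := fun {y y'} f => ip_ext fun g => ?_ }, adj⟩⟩
  have h := hip y' _ (𝟙 _) (g ≫ R'.map f)
  rw [CategoryTheory.Functor.map_id, Category.id_comp] at h
  rw [← hip, hR, ip_comp_left, dag, dag, HStarCategory.dag_dag, Category.assoc, ← hR,
    ← Functor.map_comp_assoc]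
  refine h.trans ?_
  rw [ip_id_comp_comm, ip_id_comp]

/-! ### Assembly of the functor `χ`. -/

section Character

variable {G : Type w} [Group G]

/-- The morphism of equivariant bundles `χ(σ)`. -/
noncomputable def chiHom {α β : TwoRep.{v, u} G} (σ : α ⟶ β) : chi α ⟶ chi β :=
  ObjectProperty.homMk
    { app := fun g => chiApp σ (nonempty_rightAdjoint (TwoRep.Hom.toStar σ)).some g.elt
      naturality := fun _ _ h => LinearMap.ext fun θ => conjLin_chiApp σ _ h.1 h.2 θ }

/-- The right adjoint chosen in `chiHom` is immaterial. -/
lemma chiHom_app {α β : TwoRep.{v, u} G} (σ : α ⟶ β) (R : RightAdjoint (TwoRep.Hom.toStar σ))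
    (g : LoopGroupoid G) : (chiHom σ).hom.app g = chiApp σ R g.elt :=
  chiApp_eq_of_iso (Iso.refl σ) _ R g.elt

lemma chi_hom_ext {α β : TwoRep.{v, u} G} {φ ψ : chi α ⟶ chi β}
    (h : ∀ g, φ.hom.app g = ψ.hom.app g) : φ = ψ :=
  ObjectProperty.hom_ext _ (NatTrans.ext (funext h))

end Character

end TwoHilbert

theorem mainTheorem7 {G : Type w} [Group G] [Finite G] :
    -- every morphism of unitary 2-representations has a right adjoint in 2-Hilbert spaces
    (∀ (α β : TwoRep.{v, u} G) (σ : α ⟶ β), Nonempty (RightAdjoint (TwoRep.Hom.toStar σ))) ∧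
    -- independence of the chosen right adjoint
    (∀ (α β : TwoRep.{v, u} G) (σ : α ⟶ β) (R R' : RightAdjoint (TwoRep.Hom.toStar σ)) (g : G),
      chiApp σ R g = chiApp σ R' g) ∧
    -- morphism of equivariant bundles
    (∀ (α β : TwoRep.{v, u} G) (σ : α ⟶ β) (R : RightAdjoint (TwoRep.Hom.toStar σ))
      (g g' : LoopGroupoid G) (h : g ⟶ g'),
      (chi α).obj.map h ≫ chiApp σ R g'.elt = chiApp σ R g.elt ≫ (chi β).obj.map h) ∧
    -- dependence on the isomorphism class only
    (∀ (α β : TwoRep.{v, u} G) (σ ρ : α ⟶ β), Nonempty (σ ≅ ρ) →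
      ∀ (R : RightAdjoint (TwoRep.Hom.toStar σ)) (R' : RightAdjoint (TwoRep.Hom.toStar ρ)) (g : G),
        chiApp σ R g = chiApp ρ R' g) ∧
    -- functoriality
    (∀ (α : TwoRep.{v, u} G) (R : RightAdjoint (TwoRep.Hom.toStar (𝟙 α))) (g : G),
      chiApp (𝟙 α) R g = LinearMap.id) ∧
    (∀ (α β γ : TwoRep.{v, u} G) (σ : α ⟶ β) (τ : β ⟶ γ)
      (R : RightAdjoint (TwoRep.Hom.toStar σ)) (S : RightAdjoint (TwoRep.Hom.toStar τ))
      (T : RightAdjoint (TwoRep.Hom.toStar (σ ≫ τ))) (g : G),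
      chiApp (σ ≫ τ) T g = chiApp τ S g ∘ₗ chiApp σ R g) ∧
    -- the resulting functor from the Grothendieck category
    ∃ (m : ∀ a b : GrothendieckCat (TwoRep.{v, u} G), (a ⟶ b) → (chi a.of ⟶ chi b.of))
      (m_id : ∀ a, m a a (𝟙 a) = 𝟙 (chi a.of))
      (m_comp : ∀ a b c (p : a ⟶ b) (q : b ⟶ c), m a c (p ≫ q) = m a b p ≫ m b c q),
      let X : GrothendieckCat (TwoRep.{v, u} G) ⥤ HilbG.{max u v} G :=
        { obj := fun a => chi a.of
          map := fun {a b} p => m a b p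
          map_id := m_id
          map_comp := fun {a b c} p q => m_comp a b c p q }
      ∀ (α β : TwoRep.{v, u} G) (σ : α ⟶ β) (R : RightAdjoint (TwoRep.Hom.toStar σ))
        (g : LoopGroupoid G),
        (X.map (GrothendieckCat.cls σ)).hom.app g = chiApp σ R g.elt := by
  refine ⟨fun α β σ => nonempty_rightAdjoint _,
    fun α β σ R R' g => chiApp_eq_of_iso (Iso.refl σ) R R' g,
    fun α β σ R g g' h => LinearMap.ext fun θ => conjLin_chiApp σ R h.1 h.2 θ,
    fun α β σ ρ ⟨e⟩ R R' g => chiApp_eq_of_iso e R R' g,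
    chiApp_id, fun α β γ σ τ R S T g => chiApp_comp σ τ R S T g,
    -- On isomorphism classes the map is induced by `chiHom`; invariance under isomorphism makes it
    -- well defined, and the functor laws are checked on representatives.
    fun a b => Quotient.lift (s := isIsomorphicSetoid (a.of ⟶ b.of)) chiHom
      fun σ ρ ⟨e⟩ => chi_hom_ext fun g => chiApp_eq_of_iso e _ _ g.elt,
    fun a => chi_hom_ext fun g => chiApp_id a.of _ g.elt, ?_,
    fun α β σ R g => chiHom_app σ R g⟩
  rintro a b c ⟨σ⟩ ⟨τ⟩
  exact chi_hom_ext fun g => chiApp_comp σ τ _ _ _ g.elt
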